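/- Let $m\ge 1$ be an integer and let $T>0$, $L>0$ be real numbers. Let $\Omega:=\{\omega\in C([0,T],\mathbb{R}^m):\omega(0)=0\}$ and $C_0([0,T],\mathbb{S}^m):=\{q\in C([0,T],\mathbb{S}^m): q(0)=0\}$, both with the uniform topology, where $\mathbb{R}^m$ carries the Euclidean norm and the space $\mathbb{S}^m$ of symmetric real $m\times m$ matrices carries the supremum norm $|\gamma|=\max_{i,j}|\gamma_{ij}|$. Let $$\tilde\Theta:=[0,T]\times\Omega\times\Omega\times\Omega\times C_0([0,T],\mathbb{S}^m)$$ with the product topology, generic element $\vartheta=(t,\omega,a,\mu,q)$, and projections $\mathsf{T},\mathsf{B},\mathsf{A},\mathsf{M},\mathsf{Q}$ defined by $\mathsf{T}(\vartheta)=t$, $\mathsf{B}(\vartheta)=\omega$, $\mathsf{A}(\vartheta)=a$, $\mathsf{M}(\vartheta)=\mu$, $\mathsf{Q}(\vartheta)=q$. Let $\mathbb{G}=(\mathcal{G}_t)_{t\in[0,T]}$ be the filtration $$\mathcal{G}_t:=\sigma\{[0,r]: r\le t\}\otimes\mathcal{F}_t\otimes\mathcal{F}_t\otimes\mathcal{F}_t\otimes\mathcal{F}^{\mathbb{S}}_t,$$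 where $(\mathcal{F}_t)$ and $(\mathcal{F}^{\mathbb{S}}_t)$ are the canonical filtrations of $\Omega$ and $C_0([0,T],\mathbb{S}^m)$, i.e. those generated by the evaluations at times $s\le t$. Let $\mathcal{P}$ be the set of all probability measures on $(\tilde\Theta,\mathcal{G}_T)$, endowed with the topology of weak convergence. Let $\tilde\Theta_L$ be the set of all $\vartheta=(t,\omega,a,\mu,q)\in\tilde\Theta$ such that $\omega=a+\mu$, the paths $a$ and $q$ are absolutely continuous on $[0,T]$, and $|\dot a_s|\le L$ and $|\dot q_s|\le L$ for almost every $s\in[0,T]$. Let $\mathcal{P}_L$ be the set of all $\mathbb{P}\in\mathcal{P}$ such that - $\mathbb{P}(\tilde\Theta_L)=1$; - $\mathsf{M}$ is a square-integrable martingale under $\mathbb{P}$ with respect to $\mathbb{G}$; - $\langle\mathsf{M}\rangle=\mathsf{Q}$ $\mathbb{P}$-almost surely, where $\langle\mathsf{M}\rangle$ is the $\mathbb{S}^m$-valued quadratic variation of $\mathsf{M}$: the adapted continuous process of bounded variation started at $0$, unique up to indistinguishability, such that $\mathsf{M}^{i}\mathsf{M}^{j}-\langle\mathsf{M}\rangle^{ij}$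 is a martingale for all $i,j\in\{1,\dots,m\}$. Then $\mathcal{P}_L$ is a compact subset of $\mathcal{P}$. -/

import Mathlib

open MeasureTheory Filter Topology

noncomputable section

namespace PathLaws

/-! ### Values of the paths -/

/-- `ℝ^m` with the Euclidean norm. -/
abbrev Vec (m : ℕ) : Type := EuclideanSpace ℝ (Fin m)

/-- The symmetric real `m × m` matrices as a subspace of the `m × m` arrays; its norm is the
supremum norm `max |A i j|`. -/
def symSubmodule (m : ℕ) : Submodule ℝ (Fin m → Fin m → ℝ) where
  carrier := {A | (Matrix.of A).IsSymm}
  add_mem' := fun hA hB => Matrix.IsSymm.add hA hB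
  zero_mem' := Matrix.isSymm_zero
  smul_mem' := fun c _ hA => Matrix.IsSymm.smul hA c

abbrev SymMat (m : ℕ) : Type := symSubmodule m

/-! ### The σ-algebra of a space of continuous functions -/

/-- The σ-algebra on a space of continuous functions generated by the evaluation maps. -/
instance instMeasurableSpaceContinuousMap {X E : Type*} [TopologicalSpace X] [TopologicalSpace E]
    [MeasurableSpace E] : MeasurableSpace C(X, E) :=
  ⨆ x : X, MeasurableSpace.comap (fun f : C(X, E) => f x) inferInstance

theorem measurable_eval {X E : Type*} [TopologicalSpace X] [TopologicalSpace E]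
    [MeasurableSpace E] (x : X) : Measurable (fun f : C(X, E) => f x) :=
  Measurable.mono (comap_measurable _) (le_iSup (fun x : X =>
    MeasurableSpace.comap (fun f : C(X, E) => f x) inferInstance) x) le_rfl

/-- For the uniform topology, the evaluation maps generate the Borel σ-algebra. -/
instance instBorelSpaceContinuousMap {X E : Type*} [TopologicalSpace X] [CompactSpace X]
    [LocallyCompactSpace X]
    [SecondCountableTopology X] [PseudoMetricSpace E] [SecondCountableTopology E]
    [MeasurableSpace E] [BorelSpace E] : BorelSpace C(X, E) := by
  constructor
  apply le_antisymm
  · refine iSup_le fun x => ?_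
    rw [BorelSpace.measurable_eq (α := E)]
    have h : Continuous fun f : C(X, E) => f x := by fun_prop
    exact h.borel_measurable.comap_le
  · have hball : ∀ (f : C(X, E)) (r : ℝ), 0 ≤ r → MeasurableSet (Metric.closedBall f r) := by
      intro f r hr
      obtain ⟨D, hDc, hDd⟩ := TopologicalSpace.exists_countable_dense X
      have : Metric.closedBall f r = ⋂ x ∈ D, {g : C(X, E) | dist (g x) (f x) ≤ r} := by
        ext g
        simp only [Metric.mem_closedBall, Set.mem_iInter, Set.mem_ofPred_eq,
          ContinuousMap.dist_le hr]
        refine ⟨fun h x _ => h x, fun h x => ?_⟩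
        have hcl : IsClosed {x | dist (g x) (f x) ≤ r} :=
          isClosed_le (by fun_prop) continuous_const
        exact hcl.closure_subset_iff.2 (fun x hx => h x hx) (hDd x)
      rw [this]
      refine MeasurableSet.biInter hDc fun x _ => ?_
      exact (measurable_eval x) (Metric.isClosed_closedBall (x := f x) (ε := r)).measurableSet
    refine MeasurableSpace.generateFrom_le fun U hU => ?_
    have hU' : IsOpen U := hU
    have : ∀ f ∈ U, ∃ r > 0, Metric.closedBall f r ⊆ U := fun f hf =>
      Metric.nhds_basis_closedBall.mem_iff.1 (hU'.mem_nhds hf)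
    choose! r hr hrU using this
    obtain ⟨t, htU, htc, ht⟩ := TopologicalSpace.countable_cover_nhdsWithin
      (f := fun f => Metric.closedBall f (r f)) (s := U)
      (fun f hf => mem_nhdsWithin_of_mem_nhds (Metric.closedBall_mem_nhds f (hr f hf)))
    have hEq : U = ⋃ f ∈ t, Metric.closedBall f (r f) :=
      Set.Subset.antisymm ht (Set.iUnion₂_subset fun f hf => hrU f (htU hf))
    rw [hEq]
    exact MeasurableSet.biUnion htc fun f hf => hball f _ (hr f (htU hf)).le

/-! ### The canonical space -/

/-- `C_0([0,T], E)`: the continuous `E`-valued paths on `[0,T]` that vanish at time `0`, with the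
topology of uniform convergence. -/
abbrev PathSpace (T : ℝ) (E : Type) [NormedAddCommGroup E] : Type :=
  {ω : C(Set.Icc (0 : ℝ) T, E) // ∀ s : Set.Icc (0 : ℝ) T, (s : ℝ) = 0 → ω s = 0}

/-- The enlarged canonical space `([0,T] × Ω) × Ω × Ω × C_0([0,T], 𝕊^m)`, where
`Ω = C_0([0,T], ℝ^m)`, with the product topology and the product σ-algebra. -/
abbrev Enlarged (m : ℕ) (T : ℝ) : Type :=
  (Set.Icc (0 : ℝ) T × PathSpace T (Vec m)) ×
    PathSpace T (Vec m) × PathSpace T (Vec m) × PathSpace T (SymMat m)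

set_option synthInstance.maxHeartbeats 400000 in
set_option synthInstance.maxSize 1000 in
/-- The product σ-algebra is the Borel σ-algebra of the product topology. -/
instance instBorelSpaceEnlarged (m : ℕ) (T : ℝ) : BorelSpace (Enlarged m T) := inferInstance

/-! The canonical path-valued projections. -/

def pathB {m : ℕ} {T : ℝ} (x : Enlarged m T) : C(Set.Icc (0 : ℝ) T, Vec m) := x.1.2.1

def pathA {m : ℕ} {T : ℝ} (x : Enlarged m T) : C(Set.Icc (0 : ℝ) T, Vec m) := x.2.1.1

def pathM {m : ℕ} {T : ℝ} (x : Enlarged m T) : C(Set.Icc (0 : ℝ) T, Vec m) := x.2.2.1.1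

def pathQ {m : ℕ} {T : ℝ} (x : Enlarged m T) : C(Set.Icc (0 : ℝ) T, SymMat m) := x.2.2.2.1

/-! ### The canonical filtration -/

/-- `σ{[0,r] : r ≤ t}` on `[0,T]`. -/
abbrev timeSigma {T : ℝ} (t : Set.Icc (0 : ℝ) T) : MeasurableSpace (Set.Icc (0 : ℝ) T) :=
  MeasurableSpace.generateFrom {S | ∃ r : Set.Icc (0 : ℝ) T, r ≤ t ∧ S = Set.Iic r}

/-- The canonical σ-algebra on a path space, generated by the positions at times `s ≤ t`. -/
abbrev pathSigma {T : ℝ} (E : Type) [NormedAddCommGroup E] [MeasurableSpace E]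
    (t : Set.Icc (0 : ℝ) T) : MeasurableSpace (PathSpace T E) :=
  ⨆ s : Set.Icc (0 : ℝ) T, ⨆ _ : s ≤ t,
    MeasurableSpace.comap (fun ω : PathSpace T E => ω.1 s) inferInstance

theorem timeSigma_mono {T : ℝ} {s t : Set.Icc (0 : ℝ) T} (h : s ≤ t) :
    timeSigma s ≤ timeSigma t :=
  MeasurableSpace.generateFrom_mono fun _ ⟨r, hr, hS⟩ => ⟨r, hr.trans h, hS⟩

theorem timeSigma_le {T : ℝ} (t : Set.Icc (0 : ℝ) T) :
    timeSigma t ≤ (inferInstance : MeasurableSpace (Set.Icc (0 : ℝ) T)) := by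
  refine MeasurableSpace.generateFrom_le ?_
  rintro _ ⟨r, _, rfl⟩
  exact measurableSet_Iic

theorem pathSigma_mono {T : ℝ} (E : Type) [NormedAddCommGroup E] [MeasurableSpace E]
    {s t : Set.Icc (0 : ℝ) T} (h : s ≤ t) : pathSigma E s ≤ pathSigma E t :=
  iSup₂_le fun r hr => le_iSup₂_of_le r (hr.trans h) le_rfl

theorem pathSigma_le {T : ℝ} (E : Type) [NormedAddCommGroup E] [MeasurableSpace E]
    (t : Set.Icc (0 : ℝ) T) :
    pathSigma E t ≤ (inferInstance : MeasurableSpace (PathSpace T E)) :=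
  iSup₂_le fun s _ => ((measurable_eval s).comp measurable_subtype_coe).comap_le

/-- `𝒢_t = (σ{[0,r] : r ≤ t} ⊗ ℱ_t) ⊗ ℱ_t ⊗ ℱ_t ⊗ ℱ^𝕊_t`. -/
abbrev sigmaG {m : ℕ} {T : ℝ} (t : Set.Icc (0 : ℝ) T) : MeasurableSpace (Enlarged m T) :=
  ((timeSigma t).prod (pathSigma (Vec m) t)).prod
    ((pathSigma (Vec m) t).prod ((pathSigma (Vec m) t).prod (pathSigma (SymMat m) t)))

theorem prod_mono {α β : Type*} {a a' : MeasurableSpace α} {b b' : MeasurableSpace β}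
    (ha : a ≤ a') (hb : b ≤ b') : a.prod b ≤ a'.prod b' :=
  sup_le_sup (MeasurableSpace.comap_mono ha) (MeasurableSpace.comap_mono hb)

/-- The canonical filtration `𝔾` on the enlarged canonical space. -/
def filtrationG (m : ℕ) (T : ℝ) :
    Filtration (Set.Icc (0 : ℝ) T) (inferInstance : MeasurableSpace (Enlarged m T)) where
  seq := sigmaG
  mono' := fun _ _ h =>
    prod_mono (prod_mono (timeSigma_mono h) (pathSigma_mono _ h))
      (prod_mono (pathSigma_mono _ h) (prod_mono (pathSigma_mono _ h) (pathSigma_mono _ h)))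
  le' := fun t =>
    prod_mono (prod_mono (timeSigma_le t) (pathSigma_le _ t))
      (prod_mono (pathSigma_le _ t) (prod_mono (pathSigma_le _ t) (pathSigma_le _ t)))

/-! ### Absolutely continuous paths, and the quadratic variation -/

/-- The path `f` is absolutely continuous on `[0,T]`, and `‖f'(s)‖ ≤ L` for almost every `s`. -/
def IsACWithRate {T : ℝ} (hT : 0 < T) {E : Type} [NormedAddCommGroup E] [NormedSpace ℝ E]
    (L : ℝ) (f : C(Set.Icc (0 : ℝ) T, E)) : Prop :=
  AbsolutelyContinuousOnInterval (Set.IccExtend hT.le f) 0 T ∧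
    ∀ᵐ s ∂(volume.restrict (Set.Icc 0 T)),
      ∃ v : E, HasDerivAt (Set.IccExtend hT.le f) v s ∧ ‖v‖ ≤ L

/-- `M` is a square-integrable martingale. -/
def IsSqIntMartingale {Ω : Type*} {m0 : MeasurableSpace Ω} {T : ℝ} {m : ℕ}
    (𝓕 : Filtration (Set.Icc (0 : ℝ) T) m0) (P : Measure Ω)
    (M : Set.Icc (0 : ℝ) T → Ω → Vec m) : Prop :=
  Martingale M 𝓕 P ∧ ∀ t, MemLp (M t) 2 P

/-- `A` is (a version of) the matrix-valued quadratic variation `⟨M⟩` of the continuous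
square-integrable martingale `M`: the adapted process with continuous paths of bounded variation
started at `0`, unique up to indistinguishability, for which every `M^i M^j - A^{ij}` is a
martingale. -/
structure IsQuadraticVariation {Ω : Type*} {m0 : MeasurableSpace Ω} {T : ℝ} {m : ℕ}
    (𝓕 : Filtration (Set.Icc (0 : ℝ) T) m0) (P : Measure Ω)
    (M : Set.Icc (0 : ℝ) T → Ω → Vec m) (A : Set.Icc (0 : ℝ) T → Ω → SymMat m) : Prop where
  adapted : StronglyAdapted 𝓕 A
  start : ∀ᵐ x ∂P, ∀ t : Set.Icc (0 : ℝ) T, (t : ℝ) = 0 → A t x = 0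
  continuous : ∀ᵐ x ∂P, Continuous fun t => A t x
  boundedVariation : ∀ᵐ x ∂P, BoundedVariationOn (fun t => A t x) Set.univ
  martingale : ∀ i j,
    Martingale (fun t x => M t x i * M t x j - (A t x).1 i j) 𝓕 P

/-! ### The set of laws -/

/-- The set of `(t, ω, a, μ, q)` with `ω = a + μ` and `a`, `q` absolutely continuous with
`|a'|_∞ ≤ L` and `|q'|_∞ ≤ L`. -/
def enlargedL (m : ℕ) {T : ℝ} (hT : 0 < T) (L : ℝ) : Set (Enlarged m T) :=
  {x | pathB x = pathA x + pathM x ∧ IsACWithRate hT L (pathA x) ∧ IsACWithRate hT L (pathQ x)}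

/-- The set `𝒫_L` of laws, as a subset of the space of all probability measures on the enlarged
canonical space (whose topology in Mathlib is that of weak convergence). -/
def lawsL (m : ℕ) {T : ℝ} (hT : 0 < T) (L : ℝ) : Set (ProbabilityMeasure (Enlarged m T)) :=
  {P | (P : Measure (Enlarged m T)) (enlargedL m hT L) = 1 ∧
    IsSqIntMartingale (filtrationG m T) (P : Measure (Enlarged m T)) (fun t x => pathM x t) ∧
    IsQuadraticVariation (filtrationG m T) (P : Measure (Enlarged m T))
      (fun t x => pathM x t) (fun t x => pathQ x t)}

end PathLaws

end

/-! By Prokhorov's theorem it suffices that the set of laws is tight and closed.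

Tightness. The components `A` and `Q` are `L`-Lipschitz and `B = A + M`, so only the modulus of
continuity of `M` needs probability. Since `⟨M⟩ = Q` grows at rate at most `L`, the conditional
second moment of an increment of `M` over `[s,t]` is at most `L (t - s)`. A Chebyshev bound of this
order, summed over `N` blocks of length `T / N`, does not tend to zero; a bound quadratic in `t - s`
is required. It comes from using the maximal inequality twice: a path with small jumps that reaches
level `2l` has to reach `l` and then move by `l` again, and each stage costs a factor `L (t - s) / l
^ 2`. This gives the weak fourth-order estimate `LinearIncrementBound.measure_exists_abs_sub_gt_le`,
hence `measure_modulus_gt_le`, and Arzelà–Ascoli (`isCompact_modulusSet`) supplies the compact sets.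

Closedness. Having rate at most `L` is the same as being `L`-Lipschitz (`isACWithRate_iff`), a
closed condition, so the support condition survives weak limits. The same fourth-order estimate
bounds the tails of `M_t ^ 2` by `K / l ^ 2` uniformly over the laws; this is uniform integrability,
so expectations of the unbounded continuous functions `M` and `M^i M^j - Q^{ij}` converge. The
martingale identities are tested against bounded continuous functions of the point stopped at `r`:
these are `𝒢_r`-measurable, and they determine `𝒢_s` for every `s < r`. Letting `r` decrease to `s`
finishes the argument (`martingale_of_tendsto`). -/

noncomputable section

namespace PathLaws

/-! ### A maximal inequality of fourth order for discrete time -/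

section Discrete

variable {Ω : Type*} {m0 : MeasurableSpace Ω} {μ : Measure Ω} {F : ℕ → MeasurableSpace Ω}

/-- Doob's maximal inequality, by backward induction on the starting index instead of a stopping
time: `G` is split according to whether the level is already exceeded at time `k`. On the first
piece the submartingale property applies, on the second the induction hypothesis. -/
theorem mul_measure_exists_gt_le_lintegral (hF : Monotone F) (hF0 : ∀ k, F k ≤ m0)
    {W : ℕ → Ω → ENNReal} (hW : ∀ k, Measurable[F k] (W k)) {a : ENNReal} {n : ℕ} :
    ∀ d k : ℕ, k + d = n →
      (∀ j, k ≤ j → j ≤ n → ∀ G, MeasurableSet[F j] G →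
        ∫⁻ x in G, W j x ∂μ ≤ ∫⁻ x in G, W n x ∂μ) →
      ∀ G, MeasurableSet[F k] G →
        a * μ (G ∩ {x | ∃ j, k ≤ j ∧ j ≤ n ∧ a < W j x}) ≤ ∫⁻ x in G, W n x ∂μ := by
  intro d
  induction d with
  | zero =>
    intro k hk _ G hG
    obtain rfl : k = n := by omega
    have hs : G ∩ {x | ∃ j, k ≤ j ∧ j ≤ k ∧ a < W j x} ⊆ {x | a ≤ W k x} ∩ G := by
      rintro x ⟨hx, j, h1, h2, h3⟩
      obtain rfl : j = k := le_antisymm h2 h1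
      exact ⟨h3.le, hx⟩
    calc _ ≤ a * μ ({x | a ≤ W k x} ∩ G) := by gcongr
      _ = a * (μ.restrict G) {x | a ≤ W k x} := by
        rw [Measure.restrict_apply]
        exact measurableSet_le measurable_const ((hW k).mono (hF0 k) le_rfl)
      _ ≤ _ := mul_meas_ge_le_lintegral ((hW k).mono (hF0 k) le_rfl) a
  | succ d ih =>
    intro k hk hsub G hG
    have hmeas : MeasurableSet[F k] {x | a < W k x} := hW k measurableSet_Ioi
    set G1 := G ∩ {x | a < W k x} with hG1
    set G2 := G \ {x | a < W k x} with hG2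
    have h1m : MeasurableSet[F k] G1 := hG.inter hmeas
    have h2m : MeasurableSet[F k] G2 := hG.diff hmeas
    have h1 : a * μ G1 ≤ ∫⁻ x in G1, W n x ∂μ := by
      refine le_trans ?_ (hsub k le_rfl (by omega) G1 h1m)
      rw [← setLIntegral_const]
      exact setLIntegral_mono ((hW k).mono (hF0 k) le_rfl) fun x hx => (hx.2 : a < W k x).le
    have h2 := ih (k + 1) (by omega) (fun j hj => hsub j (by omega)) G2 (hF (Nat.le_succ k) _ h2m)
    have hcover : G ∩ {x | ∃ j, k ≤ j ∧ j ≤ n ∧ a < W j x} ⊆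
        G1 ∪ (G2 ∩ {x | ∃ j, k + 1 ≤ j ∧ j ≤ n ∧ a < W j x}) := by
      rintro x ⟨hx, j, hj1, hj2, hj3⟩
      by_cases hc : a < W k x
      · exact Or.inl ⟨hx, hc⟩
      · refine Or.inr ⟨⟨hx, hc⟩, j, ?_, hj2, hj3⟩
        rcases hj1.eq_or_lt with rfl | h
        · exact absurd hj3 hc
        · exact h
    calc _ ≤ a * μ (G1 ∪ (G2 ∩ {x | ∃ j, k + 1 ≤ j ∧ j ≤ n ∧ a < W j x})) := by gcongr
      _ ≤ a * (μ G1 + μ (G2 ∩ {x | ∃ j, k + 1 ≤ j ∧ j ≤ n ∧ a < W j x})) := by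
        gcongr; exact measure_union_le _ _
      _ ≤ ∫⁻ x in G1, W n x ∂μ + ∫⁻ x in G2, W n x ∂μ := by
        rw [mul_add]; exact add_le_add h1 h2
      _ = _ := lintegral_inter_add_sdiff _ _ (hF0 k _ hmeas)

/-- The squared increments are submartingales and have conditional mean at most `V`. -/
structure IncrementBound (μ : Measure Ω) (F : ℕ → MeasurableSpace Ω) (Y : ℕ → Ω → ℝ) (n : ℕ)
    (V : ENNReal) : Prop where
  le_terminal : ∀ k j, k ≤ j → j ≤ n → ∀ G, MeasurableSet[F j] G →
    ∫⁻ x in G, ENNReal.ofReal ((Y j x - Y k x) ^ 2) ∂μ ≤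
      ∫⁻ x in G, ENNReal.ofReal ((Y n x - Y k x) ^ 2) ∂μ
  terminal_le : ∀ k, k ≤ n → ∀ G, MeasurableSet[F k] G →
    ∫⁻ x in G, ENNReal.ofReal ((Y n x - Y k x) ^ 2) ∂μ ≤ V * μ G

variable {Y : ℕ → Ω → ℝ} {n : ℕ} {V : ENNReal}

theorem IncrementBound.mul_measure_exists_abs_sub_gt_le (h : IncrementBound μ F Y n V)
    (hF : Monotone F) (hF0 : ∀ k, F k ≤ m0) (hY : ∀ k, Measurable[F k] (Y k)) {l : ℝ} (hl : 0 ≤ l)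
    {k : ℕ} (hk : k ≤ n) {G : Set Ω} (hG : MeasurableSet[F k] G) :
    ENNReal.ofReal (l ^ 2) * μ (G ∩ {x | ∃ j, k ≤ j ∧ j ≤ n ∧ l < |Y j x - Y k x|}) ≤ V * μ G := by
  -- Setting `W` to zero before `k` makes it adapted at every index, as Doob's inequality asks.
  let W : ℕ → Ω → ENNReal := fun j x => if k ≤ j then ENNReal.ofReal ((Y j x - Y k x) ^ 2) else 0
  have hWm : ∀ j, Measurable[F j] (W j) := by
    intro j
    by_cases hj : k ≤ j
    · simp only [W, hj, if_true]
      exact (((hY j).sub ((hY k).mono (hF hj) le_rfl)).pow_const 2).ennreal_ofReal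
    · simp only [W, hj, if_false]; exact measurable_const
  have hmain := mul_measure_exists_gt_le_lintegral (μ := μ) hF hF0 hWm (a := ENNReal.ofReal (l ^ 2))
    (n := n) (n - k) k (by omega) (fun j hj hjn G hG => by
      simp only [W, hj, hk, if_true]; exact h.le_terminal k j hj hjn G hG) G hG
  have hWn : W n = fun x => ENNReal.ofReal ((Y n x - Y k x) ^ 2) := by
    funext x; simp only [W, hk, if_true]
  rw [hWn] at hmain
  refine le_trans ?_ (hmain.trans (h.terminal_le k hk G hG))
  gcongr with x j h1 h2
  intro h3
  have h4 : l ^ 2 < (Y j x - Y k x) ^ 2 := by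
    rw [← sq_abs (Y j x - Y k x)]; gcongr
  simp only [W, h1, if_true]
  exact (ENNReal.ofReal_lt_ofReal_iff (lt_of_le_of_lt (sq_nonneg l) h4)).2 h4

/-- When jumps are at most `η`, the first passage of `|Y|` above `l` lands below `l + η`, so
reaching `2 * l + η` requires a further move of more than `l`. Conditionally on the past, that has
probability at most `V / l ^ 2`. The induction on `k` plays the role of the passage time. -/
theorem IncrementBound.mul_measure_inter_le (h : IncrementBound μ F Y n V)
    (hF : Monotone F) (hF0 : ∀ k, F k ≤ m0) (hY : ∀ k, Measurable[F k] (Y k)) {l η : ℝ}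
    (hl : 0 ≤ l) (hη : 0 ≤ η) :
    ∀ d k : ℕ, k + d = n → ∀ G, MeasurableSet[F k] G → (∀ x ∈ G, |Y k x| ≤ l + η) →
      ENNReal.ofReal (l ^ 2) * μ (G ∩ {x | (∃ j, k ≤ j ∧ j ≤ n ∧ 2 * l + η < |Y j x|) ∧
          ∀ j < n, |Y (j + 1) x - Y j x| ≤ η}) ≤
        V * μ (G ∩ {x | ∃ j, k ≤ j ∧ j ≤ n ∧ l < |Y j x|}) := by
  intro d
  induction d with
  | zero =>
    intro k hk G hG hGY
    obtain rfl : k = n := by omega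
    have hemp : G ∩ {x | (∃ j, k ≤ j ∧ j ≤ k ∧ 2 * l + η < |Y j x|) ∧
          ∀ j < k, |Y (j + 1) x - Y j x| ≤ η} = ∅ := by
      refine Set.eq_empty_of_forall_notMem ?_
      rintro x ⟨hx, ⟨j, h1, h2, h3⟩, -⟩
      obtain rfl : j = k := le_antisymm h2 h1
      linarith [hGY x hx]
    rw [hemp]; simp
  | succ d ih =>
    intro k hk G hG hGY
    have habs : ∀ k, Measurable[F k] fun x => |Y k x| := fun k =>
      continuous_abs.measurable.comp (hY k)
    have hmeas : MeasurableSet[F k] {x | l < |Y k x|} := habs k measurableSet_Ioi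
    have hmeas' : MeasurableSet[F (k + 1)] {x | |Y (k + 1) x| ≤ l + η} :=
      habs (k + 1) measurableSet_Iic
    set G1 := G ∩ {x | l < |Y k x|} with hG1
    set G2 := G \ {x | l < |Y k x|} with hG2
    have h1m : MeasurableSet[F k] G1 := hG.inter hmeas
    have h2m : MeasurableSet[F k] G2 := hG.diff hmeas
    set G3 := G2 ∩ {x | |Y (k + 1) x| ≤ l + η} with hG3
    have h3m : MeasurableSet[F (k + 1)] G3 :=
      MeasurableSet.inter (hF (Nat.le_succ k) _ h2m) hmeas'
    have e1 := h.mul_measure_exists_abs_sub_gt_le hF hF0 hY hl (k := k) (by omega) h1m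
    have e2 := ih (k + 1) (by omega) G3 h3m (fun x hx => hx.2)
    set E3 := {x | (∃ j, k + 1 ≤ j ∧ j ≤ n ∧ 2 * l + η < |Y j x|) ∧
          ∀ j < n, |Y (j + 1) x - Y j x| ≤ η} with hE3
    set D3 := {x | ∃ j, k + 1 ≤ j ∧ j ≤ n ∧ l < |Y j x|} with hD3
    have hcover : G ∩ {x | (∃ j, k ≤ j ∧ j ≤ n ∧ 2 * l + η < |Y j x|) ∧
          ∀ j < n, |Y (j + 1) x - Y j x| ≤ η} ⊆
        (G1 ∩ {x | ∃ j, k ≤ j ∧ j ≤ n ∧ l < |Y j x - Y k x|}) ∪ (G3 ∩ E3) := by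
      rintro x ⟨hx, ⟨j, hj1, hj2, hj3⟩, hjump⟩
      by_cases hc : l < |Y k x|
      · refine Or.inl ⟨⟨hx, hc⟩, j, hj1, hj2, ?_⟩
        have := abs_sub_abs_le_abs_sub (Y j x) (Y k x)
        linarith [hGY x hx]
      · have hc' : |Y k x| ≤ l := not_lt.1 hc
        refine Or.inr ⟨⟨⟨hx, hc⟩, ?_⟩, ⟨j, ?_, hj2, hj3⟩, hjump⟩
        · have h5 := hjump k (by omega)
          have := abs_sub_abs_le_abs_sub (Y (k + 1) x) (Y k x)
          change |Y (k + 1) x| ≤ l + η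
          linarith
        · rcases hj1.eq_or_lt with rfl | h
          · linarith
          · exact h
    -- The two events are separated by whether `|Y k|` exceeds `l`, so their measures add without
    -- loss and the constant does not grow through the induction.
    have hsum : μ G1 + μ (G3 ∩ D3) ≤ μ (G ∩ {x | ∃ j, k ≤ j ∧ j ≤ n ∧ l < |Y j x|}) := by
      rw [← measure_inter_add_sdiff (G ∩ {x | ∃ j, k ≤ j ∧ j ≤ n ∧ l < |Y j x|}) (hF0 k _ hmeas)]
      refine add_le_add (measure_mono ?_) (measure_mono ?_)
      · rintro x ⟨hx, hx'⟩
        exact ⟨⟨hx, k, le_rfl, by omega, hx'⟩, hx'⟩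
      · rintro x ⟨⟨⟨hx, hx'⟩, -⟩, j, h1, h2, h3⟩
        exact ⟨⟨hx, j, by omega, h2, h3⟩, hx'⟩
    calc _ ≤ ENNReal.ofReal (l ^ 2) *
          μ ((G1 ∩ {x | ∃ j, k ≤ j ∧ j ≤ n ∧ l < |Y j x - Y k x|}) ∪ (G3 ∩ E3)) := by gcongr
      _ ≤ ENNReal.ofReal (l ^ 2) *
          (μ (G1 ∩ {x | ∃ j, k ≤ j ∧ j ≤ n ∧ l < |Y j x - Y k x|}) + μ (G3 ∩ E3)) := by
        gcongr; exact measure_union_le _ _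
      _ ≤ V * μ G1 + V * μ (G3 ∩ D3) := by rw [mul_add]; exact add_le_add e1 e2
      _ ≤ _ := by rw [← mul_add]; gcongr

theorem IncrementBound.sq_mul_measure_le [IsProbabilityMeasure μ] (h : IncrementBound μ F Y n V)
    (hF : Monotone F) (hF0 : ∀ k, F k ≤ m0) (hY : ∀ k, Measurable[F k] (Y k))
    (hY0 : ∀ x, Y 0 x = 0) {l η : ℝ} (hl : 0 ≤ l) (hη : 0 ≤ η) :
    ENNReal.ofReal (l ^ 2) * (ENNReal.ofReal (l ^ 2) *
        μ {x | (∃ j ≤ n, 2 * l + η < |Y j x|) ∧ ∀ j < n, |Y (j + 1) x - Y j x| ≤ η}) ≤ V * V := by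
  have h1 := h.mul_measure_inter_le hF hF0 hY hl hη n 0 (by omega) Set.univ
    (@MeasurableSet.univ _ (F 0)) (fun x _ => by rw [hY0, abs_zero]; positivity)
  have h2 := h.mul_measure_exists_abs_sub_gt_le hF hF0 hY hl (k := 0) (by omega)
    (@MeasurableSet.univ _ (F 0))
  simp only [hY0, sub_zero, Set.univ_inter, zero_le, true_and, measure_univ, mul_one] at h1 h2
  calc _ ≤ ENNReal.ofReal (l ^ 2) * (V * μ {x | ∃ j ≤ n, l < |Y j x|}) := by gcongr
    _ = V * (ENNReal.ofReal (l ^ 2) * μ {x | ∃ j ≤ n, l < |Y j x|}) := by ring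
    _ ≤ _ := by gcongr

end Discrete

/-! ### The modulus of continuity of a continuous martingale -/

section ContinuousTime

variable {Ω : Type*} {m0 : MeasurableSpace Ω} {T : ℝ}

/-- The squared increments are submartingales, and their conditional mean is at most `C` times the
length of the time interval. -/
structure LinearIncrementBound (μ : Measure Ω) (𝓕 : Filtration (Set.Icc (0 : ℝ) T) m0)
    (X : Set.Icc (0 : ℝ) T → Ω → ℝ) (C : ℝ) : Prop where
  le_terminal : ∀ s r t, s ≤ r → r ≤ t → ∀ G, MeasurableSet[𝓕 r] G →
    ∫⁻ x in G, ENNReal.ofReal ((X r x - X s x) ^ 2) ∂μ ≤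
      ∫⁻ x in G, ENNReal.ofReal ((X t x - X s x) ^ 2) ∂μ
  terminal_le : ∀ s t, s ≤ t → ∀ G, MeasurableSet[𝓕 s] G →
    ∫⁻ x in G, ENNReal.ofReal ((X t x - X s x) ^ 2) ∂μ ≤ ENNReal.ofReal (C * (t - s)) * μ G

/-- The points `s + k (t - s) / N`, stopped at `t`. -/
def gridPoint (s t : Set.Icc (0 : ℝ) T) (N k : ℕ) : Set.Icc (0 : ℝ) T :=
  -- With `max s t` in place of `t` the point stays in `[0,T]` even without `s ≤ t`.
  ⟨min (max (s : ℝ) (t : ℝ)) (s + k * (max (s : ℝ) (t : ℝ) - s) / N), by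
    have h1 := s.2.1
    have h2 := t.2.2
    have h3 : (0 : ℝ) ≤ max (s : ℝ) t - s := sub_nonneg.2 (le_max_left _ _)
    constructor
    · exact le_min (h1.trans (le_max_left _ _)) (by positivity)
    · exact (min_le_left _ _).trans (max_le s.2.2 h2)⟩

theorem coe_gridPoint {s t : Set.Icc (0 : ℝ) T} (h : s ≤ t) (N k : ℕ) :
    (gridPoint s t N k : ℝ) = min (t : ℝ) (s + k * (t - s) / N) := by
  have h' : (s : ℝ) ≤ t := h
  simp only [gridPoint, max_eq_right h']

theorem gridPoint_zero {s t : Set.Icc (0 : ℝ) T} (h : s ≤ t) (N : ℕ) : gridPoint s t N 0 = s := by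
  apply Subtype.ext
  have h' : (s : ℝ) ≤ t := h
  simp [coe_gridPoint h, h']

theorem gridPoint_self {s t : Set.Icc (0 : ℝ) T} (h : s ≤ t) {N : ℕ} (hN : 0 < N) :
    gridPoint s t N N = t := by
  apply Subtype.ext
  have hN' : (N : ℝ) ≠ 0 := by positivity
  rw [coe_gridPoint h, mul_div_assoc, mul_div_cancel₀ _ hN']
  simp

theorem gridPoint_mono {s t : Set.Icc (0 : ℝ) T} (h : s ≤ t) (N : ℕ) :
    Monotone (gridPoint s t N) := by
  intro j k hjk
  have h' : (0 : ℝ) ≤ t - s := sub_nonneg.2 h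
  change (gridPoint s t N j : ℝ) ≤ gridPoint s t N k
  rw [coe_gridPoint h, coe_gridPoint h]
  gcongr

theorem dist_gridPoint_succ_le {s t : Set.Icc (0 : ℝ) T} (h : s ≤ t) (N k : ℕ) :
    dist (gridPoint s t N (k + 1)) (gridPoint s t N k) ≤ (t - s) / N := by
  have h' : (0 : ℝ) ≤ t - s := sub_nonneg.2 h
  have h0 : (0 : ℝ) ≤ (t - s) / N := by positivity
  have hm : (gridPoint s t N k : ℝ) ≤ gridPoint s t N (k + 1) := gridPoint_mono h N (Nat.le_succ k)
  rw [Subtype.dist_eq, Real.dist_eq, abs_of_nonneg (sub_nonneg.2 hm), coe_gridPoint h,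
    coe_gridPoint h]
  have e : (s : ℝ) + ((k + 1 : ℕ) : ℝ) * (t - s) / N = s + k * (t - s) / N + (t - s) / N := by
    push_cast; ring
  rw [e]
  rcases min_cases (t : ℝ) (s + k * (t - s) / N) with ⟨h1, h2⟩ | ⟨h1, h2⟩
  · rw [h1]; linarith [min_le_left (t : ℝ) (s + k * (t - s) / N + (t - s) / N)]
  · rw [h1]; linarith [min_le_right (t : ℝ) (s + k * (t - s) / N + (t - s) / N)]

theorem exists_gridPoint_near {s t u : Set.Icc (0 : ℝ) T} (hsu : s ≤ u) (hut : u ≤ t) {N : ℕ}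
    (hN : 0 < N) : ∃ j ≤ N, dist u (gridPoint s t N j) ≤ (t - s) / N ∧ gridPoint s t N j ≤ u := by
  have h : s ≤ t := hsu.trans hut
  have hN' : (0 : ℝ) < N := by positivity
  have h1 : (s : ℝ) ≤ u := hsu
  have h2 : (u : ℝ) ≤ t := hut
  rcases (h1.trans h2).eq_or_lt with he | hlt
  · refine ⟨0, hN.le, ?_, ?_⟩
    · rw [gridPoint_zero h, Subtype.dist_eq, Real.dist_eq, abs_of_nonneg (by linarith), he]
      rw [sub_self, zero_div]; linarith
    · rw [gridPoint_zero h]; exact hsu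
  · have hd : (0 : ℝ) < t - s := by linarith
    set q : ℝ := (u - s) * N / (t - s) with hq
    have hq0 : 0 ≤ q := by have : (0 : ℝ) ≤ u - s := by linarith
                           positivity
    have hqN : q ≤ N := by
      rw [hq, div_le_iff₀ hd, mul_comm]; gcongr
    have hf1 := Nat.floor_le hq0
    have hf2 := Nat.lt_floor_add_one q
    have hqe : (u : ℝ) = s + q * (t - s) / N := by rw [hq]; field_simp; ring
    have hle : (s : ℝ) + ⌊q⌋₊ * (t - s) / N ≤ u := by
      rw [hqe]; gcongr
    have hlt' : (u : ℝ) ≤ s + ⌊q⌋₊ * (t - s) / N + (t - s) / N := by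
      have : q * (t - s) / N ≤ (⌊q⌋₊ + 1) * (t - s) / N := by gcongr
      have e : ((⌊q⌋₊ : ℝ) + 1) * (t - s) / N = ⌊q⌋₊ * (t - s) / N + (t - s) / N := by ring
      linarith
    have hc : (gridPoint s t N ⌊q⌋₊ : ℝ) = s + ⌊q⌋₊ * (t - s) / N := by
      rw [coe_gridPoint h]; exact min_eq_right (hle.trans h2)
    refine ⟨⌊q⌋₊, ?_, ?_, ?_⟩
    · exact_mod_cast hf1.trans hqN
    · rw [Subtype.dist_eq, Real.dist_eq, hc, abs_of_nonneg (by linarith)]; linarith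
    · change (gridPoint s t N ⌊q⌋₊ : ℝ) ≤ u
      rw [hc]; exact hle

variable {μ : Measure Ω} {𝓕 : Filtration (Set.Icc (0 : ℝ) T) m0}
  {X : Set.Icc (0 : ℝ) T → Ω → ℝ} {C : ℝ}

theorem LinearIncrementBound.incrementBound (h : LinearIncrementBound μ 𝓕 X C) (hC : 0 ≤ C)
    {s t : Set.Icc (0 : ℝ) T} (hst : s ≤ t) {N : ℕ} (hN : 0 < N) :
    IncrementBound μ (fun k => 𝓕 (gridPoint s t N k))
      (fun k x => X (gridPoint s t N k) x - X s x) N (ENNReal.ofReal (C * (t - s))) := by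
  constructor
  · intro k j hkj hjN G hG
    simp only [sub_sub_sub_cancel_right]
    exact h.le_terminal _ _ _ (gridPoint_mono hst N hkj) (gridPoint_mono hst N hjN) G hG
  · intro k hk G hG
    simp only [sub_sub_sub_cancel_right]
    refine (h.terminal_le _ _ (gridPoint_mono hst N hk) G hG).trans ?_
    have h1 : (s : ℝ) ≤ gridPoint s t N k := by
      have := gridPoint_mono hst N (Nat.zero_le k)
      rw [gridPoint_zero hst] at this
      exact this
    rw [gridPoint_self hst hN]
    gcongr

/-- The discrete estimate is applied on finer and finer grids with `η = l / 2`. By uniform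
continuity of the path, on every fine grid all jumps are at most `l / 2` and a crossing of `3 * l`
is seen as a crossing of `2 * l + l / 2`. -/
theorem LinearIncrementBound.measure_exists_abs_sub_gt_le [IsProbabilityMeasure μ]
    (h : LinearIncrementBound μ 𝓕 X C) (hC : 0 ≤ C) (hX : ∀ t, Measurable[𝓕 t] (X t))
    (hXc : ∀ x, Continuous fun t => X t x) {s t : Set.Icc (0 : ℝ) T} (hst : s ≤ t) {l : ℝ}
    (hl : 0 < l) :
    μ {x | ∃ u, s ≤ u ∧ u ≤ t ∧ 3 * l < |X u x - X s x|} ≤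
      ENNReal.ofReal ((C * (t - s)) ^ 2 / l ^ 4) := by
  let E : ℕ → Set Ω := fun N => {x | (∃ j ≤ N + 1, 2 * l + l / 2 <
      |X (gridPoint s t (N + 1) j) x - X s x|) ∧ ∀ j < N + 1,
      |(X (gridPoint s t (N + 1) (j + 1)) x - X s x) -
        (X (gridPoint s t (N + 1) j) x - X s x)| ≤ l / 2}
  have hst' : (0 : ℝ) ≤ t - s := sub_nonneg.2 hst
  have hE : ∀ N, μ (E N) ≤ ENNReal.ofReal ((C * (t - s)) ^ 2 / l ^ 4) := by
    intro N
    have hsm : ∀ k, Measurable[𝓕 (gridPoint s t (N + 1) k)] (X s) := fun k => by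
      refine (hX s).mono (𝓕.mono ?_) le_rfl
      have := gridPoint_mono hst (N + 1) (Nat.zero_le k)
      rwa [gridPoint_zero hst] at this
    have key := (h.incrementBound hC hst (Nat.succ_pos N)).sq_mul_measure_le
      (fun j k hjk => 𝓕.mono (gridPoint_mono hst _ hjk)) (fun k => 𝓕.le _)
      (fun k => (hX _).sub (hsm k))
      (fun x => by simp [gridPoint_zero hst]) hl.le (half_pos hl).le
    rw [← mul_assoc, ← ENNReal.ofReal_mul (by positivity), ← ENNReal.ofReal_mul (by positivity)]
      at key
    have hpos : 0 < l ^ 2 * l ^ 2 := by positivity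
    rw [mul_comm, ← ENNReal.le_div_iff_mul_le
      (Or.inl (ENNReal.ofReal_pos.2 hpos).ne') (Or.inl ENNReal.ofReal_ne_top),
      ← ENNReal.ofReal_div_of_pos hpos] at key
    have e : C * (↑t - ↑s) * (C * (↑t - ↑s)) / (l ^ 2 * l ^ 2) = (C * (t - s)) ^ 2 / l ^ 4 := by
      ring
    rw [e] at key
    exact key
  -- The event lies in the lower limit of the grid events, an increasing union, so the uniform bound
  -- passes to it by continuity from below.
  have hsub : {x | ∃ u, s ≤ u ∧ u ≤ t ∧ 3 * l < |X u x - X s x|} ⊆ ⋃ n, ⋂ k ≥ n, E k := by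
    rintro x ⟨u, hsu, hut, hu⟩
    have huc : UniformContinuous fun t => X t x :=
      CompactSpace.uniformContinuous_of_continuous (hXc x)
    obtain ⟨δ, hδ, hδX⟩ := Metric.uniformContinuous_iff.1 huc (l / 2) (half_pos hl)
    obtain ⟨n, hn⟩ := exists_nat_gt ((t - s) / δ)
    refine Set.mem_iUnion.2 ⟨n, Set.mem_iInter₂.2 fun k hk => ?_⟩
    have hsmall : ((t : ℝ) - s) / ((k + 1 : ℕ) : ℝ) < δ := by
      rw [div_lt_iff₀ (by positivity)]
      rw [div_lt_iff₀ hδ] at hn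
      have : (n : ℝ) ≤ ((k + 1 : ℕ) : ℝ) := by exact_mod_cast (le_trans hk (Nat.le_succ k))
      nlinarith
    refine ⟨?_, fun j _ => ?_⟩
    · obtain ⟨j, hj, hd, -⟩ := exists_gridPoint_near hsu hut (Nat.succ_pos k)
      refine ⟨j, hj, ?_⟩
      have h1 : |X u x - X (gridPoint s t (k + 1) j) x| < l / 2 := by
        have := hδX (lt_of_le_of_lt hd hsmall)
        rwa [Real.dist_eq] at this
      have h2 := abs_sub_le (X u x) (X (gridPoint s t (k + 1) j) x) (X s x)
      linarith
    · rw [sub_sub_sub_cancel_right]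
      have := hδX (lt_of_le_of_lt (dist_gridPoint_succ_le hst (k + 1) j) hsmall)
      rw [Real.dist_eq] at this
      exact this.le
  refine (measure_mono hsub).trans ?_
  have hmono : Monotone fun n => ⋂ k ≥ n, E k := fun a b hab =>
    Set.iInter₂_mono' fun k hk => ⟨k, le_trans hab hk, subset_rfl⟩
  rw [hmono.measure_iUnion]
  exact iSup_le fun n => (measure_mono (Set.iInter₂_subset n le_rfl)).trans (hE n)

/-- Two times at distance at most `T / N` lie in a common block `[p k, p (k + 2)]`, the blocks being
overlapping. There are `N + 1 ≤ 2 * N` blocks, each contributing order `N⁻²`, so the total is of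
order `1 / N`. -/
theorem LinearIncrementBound.measure_modulus_gt_le [IsProbabilityMeasure μ] (hT : 0 < T)
    (h : LinearIncrementBound μ 𝓕 X C) (hC : 0 ≤ C) (hX : ∀ t, Measurable[𝓕 t] (X t))
    (hXc : ∀ x, Continuous fun t => X t x) {l : ℝ} (hl : 0 < l) {N : ℕ} (hN : 0 < N) :
    μ {x | ∃ u v, dist u v ≤ T / N ∧ 6 * l < |X u x - X v x|} ≤
      ENNReal.ofReal (8 * (C * T) ^ 2 / (l ^ 4 * N)) := by
  let a : Set.Icc (0 : ℝ) T := ⟨0, le_rfl, hT.le⟩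
  let b : Set.Icc (0 : ℝ) T := ⟨T, hT.le, le_rfl⟩
  have hab : a ≤ b := hT.le
  have hN' : (0 : ℝ) < N := by positivity
  let p : ℕ → Set.Icc (0 : ℝ) T := gridPoint a b N
  have hp : ∀ k, dist (p (k + 1)) (p k) ≤ T / N := fun k => by
    simpa [a, b] using dist_gridPoint_succ_le hab N k
  have hpc : ∀ k : ℕ, (p k : ℝ) = min T (k * T / N) := fun k => by
    simp [p, coe_gridPoint hab, a, b]
  let E : ℕ → Set Ω := fun k => {x | ∃ u, p k ≤ u ∧ u ≤ p (k + 2) ∧ 3 * l < |X u x - X (p k) x|}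
  have hE : ∀ k, μ (E k) ≤ ENNReal.ofReal ((C * (2 * T / N)) ^ 2 / l ^ 4) := by
    intro k
    have hm : p k ≤ p (k + 2) := gridPoint_mono hab N (by omega)
    refine (h.measure_exists_abs_sub_gt_le hC hX hXc hm hl).trans ?_
    have h0 : (0 : ℝ) ≤ p (k + 2) - p k := sub_nonneg.2 hm
    have h1 : (p (k + 2) : ℝ) - p k ≤ 2 * T / N := by
      have e1 := (abs_le.1 ((Real.dist_eq _ _).symm.le.trans (hp k))).2
      have e2 := (abs_le.1 ((Real.dist_eq _ _).symm.le.trans (hp (k + 1)))).2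
      have e3 : 2 * T / N = T / N + T / N := by ring
      linarith
    gcongr
  have hsub : {x | ∃ u v, dist u v ≤ T / N ∧ 6 * l < |X u x - X v x|} ⊆
      ⋃ k ∈ Finset.range (N + 1), E k := by
    have main : ∀ x, ∀ u v : Set.Icc (0 : ℝ) T, u ≤ v → dist u v ≤ T / N →
        6 * l < |X u x - X v x| → x ∈ ⋃ k ∈ Finset.range (N + 1), E k := by
      intro x u v huv hd hlt
      have hau : a ≤ u := u.2.1
      have hub : u ≤ b := u.2.2
      obtain ⟨j, hj, hjd, hju⟩ := exists_gridPoint_near hau hub hN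
      have huv' : (u : ℝ) ≤ v := huv
      have e1 : (v : ℝ) - u ≤ T / N := by
        rw [dist_comm, Subtype.dist_eq, Real.dist_eq] at hd
        exact (abs_le.1 hd).2
      have e2 : (u : ℝ) - p j ≤ T / N := by
        rw [Subtype.dist_eq, Real.dist_eq] at hjd
        simpa [a, b] using (abs_le.1 hjd).2
      have hvp : v ≤ p (j + 2) := by
        change (v : ℝ) ≤ p (j + 2)
        rw [hpc]
        refine le_min v.2.2 ?_
        have e3 : (p j : ℝ) ≤ j * T / N := by rw [hpc]; exact min_le_right _ _
        have e4 : ((j + 2 : ℕ) : ℝ) * T / N = j * T / N + T / N + T / N := by push_cast; ring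
        linarith
      refine Set.mem_biUnion (Finset.mem_coe.2 (Finset.mem_range.2 (Nat.lt_succ_of_le hj))) ?_
      by_cases hu : 3 * l < |X u x - X (p j) x|
      · exact ⟨u, hju, huv.trans hvp, hu⟩
      · refine ⟨v, hju.trans huv, hvp, ?_⟩
        have := abs_sub_le (X u x) (X (p j) x) (X v x)
        rw [abs_sub_comm (X (p j) x)] at this
        linarith
    rintro x ⟨u, v, hd, hlt⟩
    rcases le_total u v with huv | huv
    · exact main x u v huv hd hlt
    · exact main x v u huv (by rwa [dist_comm]) (by rwa [abs_sub_comm])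
  calc _ ≤ ∑ k ∈ Finset.range (N + 1), μ (E k) :=
        (measure_mono hsub).trans (measure_biUnion_finset_le _ _)
    _ ≤ ∑ k ∈ Finset.range (N + 1), ENNReal.ofReal ((C * (2 * T / N)) ^ 2 / l ^ 4) :=
        Finset.sum_le_sum fun k _ => hE k
    _ = ENNReal.ofReal ((N + 1) * ((C * (2 * T / N)) ^ 2 / l ^ 4)) := by
        rw [Finset.sum_const, Finset.card_range, nsmul_eq_mul, ENNReal.ofReal_mul (by positivity)]
        congr 1
        rw [← Nat.cast_succ, ENNReal.ofReal_natCast]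
    _ ≤ _ := by
        apply ENNReal.ofReal_le_ofReal
        have h1 : (1 : ℝ) ≤ N := by exact_mod_cast hN
        calc ((N : ℝ) + 1) * ((C * (2 * T / N)) ^ 2 / l ^ 4)
            ≤ (2 * N) * ((C * (2 * T / N)) ^ 2 / l ^ 4) := by gcongr; linarith
          _ = _ := by field_simp; ring

end ContinuousTime

/-! ### Uniform integrability from a quadratic tail bound -/

section Tail

variable {Ω : Type*} {m0 : MeasurableSpace Ω} {μ : Measure Ω} {f g : Ω → ℝ} {K : ℝ}

/-- The tails of `f` satisfy `μ (|f| > t) ≤ K / t²`. -/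
def QuadraticTail (μ : Measure Ω) (f : Ω → ℝ) (K : ℝ) : Prop :=
  ∀ t : ℝ, 0 < t → μ {x | t < |f x|} ≤ ENNReal.ofReal (K / t ^ 2)

theorem QuadraticTail.mono (h : QuadraticTail μ f K) (hgf : ∀ x, |g x| ≤ |f x|) :
    QuadraticTail μ g K := fun t ht =>
  (measure_mono fun x (hx : t < |g x|) => hx.trans_le (hgf x)).trans (h t ht)

theorem QuadraticTail.mono_const (h : QuadraticTail μ f K) {K' : ℝ} (hK : K ≤ K') :
    QuadraticTail μ f K' := fun t ht =>
  (h t ht).trans (ENNReal.ofReal_le_ofReal (by gcongr))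

theorem QuadraticTail.sub {K' : ℝ} (hf : QuadraticTail μ f K) (hg : QuadraticTail μ g K')
    (hK : 0 ≤ K) (hK' : 0 ≤ K') : QuadraticTail μ (fun x => f x - g x) (4 * (K + K')) := by
  intro t ht
  have hsub : {x | t < |f x - g x|} ⊆ {x | t / 2 < |f x|} ∪ {x | t / 2 < |g x|} := by
    intro x (hx : t < |f x - g x|)
    by_contra hc
    simp only [Set.mem_union, Set.mem_ofPred_eq, not_or, not_lt] at hc
    have := abs_sub (f x) (g x)
    linarith [hc.1, hc.2]
  calc _ ≤ μ {x | t / 2 < |f x|} + μ {x | t / 2 < |g x|} :=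
        (measure_mono hsub).trans (measure_union_le _ _)
    _ ≤ ENNReal.ofReal (K / (t / 2) ^ 2) + ENNReal.ofReal (K' / (t / 2) ^ 2) :=
        add_le_add (hf _ (half_pos ht)) (hg _ (half_pos ht))
    _ = _ := by
        rw [← ENNReal.ofReal_add (by positivity) (by positivity)]
        congr 1; field_simp; ring

theorem QuadraticTail.const_mul (h : QuadraticTail μ f K) {c : ℝ} (hc : 0 < c) :
    QuadraticTail μ (fun x => c * f x) (K * c ^ 2) := by
  intro t ht
  have hsub : {x | t < |c * f x|} ⊆ {x | t / c < |f x|} := by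
    intro x (hx : t < |c * f x|)
    rw [abs_mul, abs_of_pos hc] at hx
    change t / c < |f x|
    rw [div_lt_iff₀ hc]
    linarith
  refine (measure_mono hsub).trans ((h _ (div_pos ht hc)).trans_eq ?_)
  congr 1
  field_simp

theorem QuadraticTail.mul_of_sq {K' : ℝ}
    (hf : QuadraticTail μ (fun x => f x ^ 2) K) (hg : QuadraticTail μ (fun x => g x ^ 2) K')
    (hK : 0 ≤ K) (hK' : 0 ≤ K') : QuadraticTail μ (fun x => f x * g x) (K + K') := by
  intro t ht
  have hsub : {x | t < |f x * g x|} ⊆ {x | t < |f x ^ 2|} ∪ {x | t < |g x ^ 2|} := by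
    intro x (hx : t < |f x * g x|)
    by_contra hc
    simp only [Set.mem_union, Set.mem_ofPred_eq, not_or, not_lt, abs_pow] at hc
    rw [abs_mul] at hx
    nlinarith [hc.1, hc.2, sq_nonneg (|f x| - |g x|)]
  calc _ ≤ μ {x | t < |f x ^ 2|} + μ {x | t < |g x ^ 2|} :=
        (measure_mono hsub).trans (measure_union_le _ _)
    _ ≤ ENNReal.ofReal (K / t ^ 2) + ENNReal.ofReal (K' / t ^ 2) :=
        add_le_add (hf _ ht) (hg _ ht)
    _ = _ := by
        rw [← ENNReal.ofReal_add (by positivity) (by positivity)]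
        congr 1; ring

theorem lintegral_Ioi_inv_sq_le (hK : 0 ≤ K) {R : ℝ} (hR : 0 < R) :
    ∫⁻ t in Set.Ioi (0 : ℝ), ENNReal.ofReal (K / (t + R) ^ 2) = ENNReal.ofReal (K / R) := by
  have hd : ∀ t ∈ Set.Ici (0 : ℝ), HasDerivAt (fun t => -K * (t + R)⁻¹) (K / (t + R) ^ 2) t := by
    intro t (ht : 0 ≤ t)
    have h0 : t + R ≠ 0 := by positivity
    have h1 := (((hasDerivAt_id t).add_const R).inv h0).const_mul (-K)
    convert! h1 using 1
    simp only [id]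
    ring
  have hlim : Tendsto (fun t : ℝ => -K * (t + R)⁻¹) atTop (𝓝 0) := by
    have h1 : Tendsto (fun t : ℝ => (t + R)⁻¹) atTop (𝓝 0) :=
      tendsto_inv_atTop_zero.comp (tendsto_atTop_add_const_right _ _ tendsto_id)
    simpa using h1.const_mul (-K)
  have hpos : ∀ t ∈ Set.Ioi (0 : ℝ), 0 ≤ K / (t + R) ^ 2 := fun t _ => by positivity
  have hint := integrableOn_Ioi_deriv_of_nonneg' hd hpos hlim
  have hval := integral_Ioi_of_hasDerivAt_of_nonneg' hd hpos hlim
  rw [← ofReal_integral_eq_lintegral_ofReal hint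
    ((ae_restrict_iff' measurableSet_Ioi).2 (Eventually.of_forall hpos)), hval]
  congr 1
  simp [div_eq_mul_inv]

/-- Truncation at the levels `±R`. -/
def clamp (R y : ℝ) : ℝ := max (-R) (min R y)

theorem continuous_clamp (R : ℝ) : Continuous (clamp R) := by
  unfold clamp; fun_prop

theorem abs_clamp_le {R : ℝ} (hR : 0 ≤ R) (y : ℝ) : |clamp R y| ≤ R :=
  abs_le.2 ⟨le_max_left _ _, max_le (by linarith) (min_le_left _ _)⟩

theorem abs_sub_clamp {R : ℝ} (hR : 0 ≤ R) (y : ℝ) : |y - clamp R y| = max (|y| - R) 0 := by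
  unfold clamp
  rcases le_total R y with h | h
  · rw [min_eq_left h, max_eq_right (by linarith), abs_of_nonneg (by linarith),
      abs_of_nonneg (by linarith), max_eq_left (by linarith)]
  · rw [min_eq_right h]
    rcases le_total (-R) y with h' | h'
    · rw [max_eq_right h', sub_self, abs_zero, max_eq_right]
      linarith [abs_le.2 ⟨h', h⟩]
    · rw [max_eq_left h', abs_of_nonpos (by linarith), abs_of_nonpos (by linarith),
        max_eq_left (by linarith)]
      ring

/-- The truncation error exceeds `t` only where `|f| > t + R`; the layer-cake formula then
integrates `K / (t + R) ^ 2` to `K / R`. This is a quantitative form of uniform integrability. -/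
theorem QuadraticTail.lintegral_sub_clamp_le (h : QuadraticTail μ f K) (hK : 0 ≤ K)
    (hf : AEMeasurable f μ) {R : ℝ} (hR : 0 < R) :
    ∫⁻ x, ENNReal.ofReal |f x - clamp R (f x)| ∂μ ≤ ENNReal.ofReal (K / R) := by
  have hm : AEMeasurable (fun x => |f x - clamp R (f x)|) μ :=
    continuous_abs.measurable.comp_aemeasurable
      (hf.sub ((continuous_clamp R).measurable.comp_aemeasurable hf))
  rw [lintegral_eq_lintegral_meas_lt μ (Eventually.of_forall fun x => abs_nonneg _) hm,
    ← lintegral_Ioi_inv_sq_le hK hR]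
  refine setLIntegral_mono' measurableSet_Ioi fun t (ht : 0 < t) => ?_
  refine le_trans (measure_mono ?_) (h (t + R) (by positivity))
  intro x (hx : t < |f x - clamp R (f x)|)
  rw [abs_sub_clamp hR.le] at hx
  rcases lt_max_iff.1 hx with h1 | h1
  · change t + R < |f x|; linarith
  · linarith

theorem QuadraticTail.integrable [IsFiniteMeasure μ] (h : QuadraticTail μ f K) (hK : 0 ≤ K)
    (hf : AEStronglyMeasurable f μ) : Integrable f μ := by
  have hc : AEStronglyMeasurable (fun x => clamp 1 (f x)) μ :=
    (continuous_clamp 1).comp_aestronglyMeasurable hf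
  have h1 : Integrable (fun x => f x - clamp 1 (f x)) μ := by
    refine ⟨hf.sub hc, ?_⟩
    rw [hasFiniteIntegral_iff_norm]
    exact (h.lintegral_sub_clamp_le hK hf.aemeasurable one_pos).trans_lt ENNReal.ofReal_lt_top
  have h2 : Integrable (fun x => clamp 1 (f x)) μ :=
    Integrable.of_bound hc 1 (Eventually.of_forall fun x => abs_clamp_le zero_le_one _)
  exact (h1.add h2).congr (Eventually.of_forall fun x => by simp)

theorem QuadraticTail.abs_integral_sub_le [IsFiniteMeasure μ] (h : QuadraticTail μ f K)
    (hK : 0 ≤ K) (hf : AEStronglyMeasurable f μ) {R : ℝ} (hR : 0 < R) :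
    |∫ x, f x ∂μ - ∫ x, clamp R (f x) ∂μ| ≤ K / R := by
  have hc : AEStronglyMeasurable (fun x => clamp R (f x)) μ :=
    (continuous_clamp R).comp_aestronglyMeasurable hf
  have h2 : Integrable (fun x => clamp R (f x)) μ :=
    Integrable.of_bound hc R (Eventually.of_forall fun x => abs_clamp_le hR.le _)
  rw [← integral_sub (h.integrable hK hf) h2, ← Real.norm_eq_abs]
  refine (norm_integral_le_lintegral_norm _).trans ?_
  exact ENNReal.toReal_le_of_le_ofReal (by positivity)
    (h.lintegral_sub_clamp_le hK hf.aemeasurable hR)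

theorem tendsto_of_forall_truncation {ι : Type*} {l : Filter ι} {a : ι → ℝ} {b : ℝ} {K : ℝ}
    (hK : 0 ≤ K) (a' : ℝ → ι → ℝ) (b' : ℝ → ℝ)
    (ha : ∀ R, 0 < R → ∀ᶠ i in l, |a i - a' R i| ≤ K / R) (hb : ∀ R, 0 < R → |b - b' R| ≤ K / R)
    (h : ∀ R, 0 < R → Tendsto (a' R) l (𝓝 (b' R))) : Tendsto a l (𝓝 b) := by
  rw [Metric.tendsto_nhds]
  intro ε hε
  -- This choice gives `K / R < ε / 3`, and the `+ 1` keeps `R` positive when `K = 0`.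
  set R : ℝ := (4 * K + 1) / ε with hR
  have hRpos : 0 < R := by positivity
  have hKR : K / R < ε / 3 := by
    rw [hR, div_div_eq_mul_div, div_lt_div_iff₀ (by positivity) (by positivity)]
    nlinarith
  filter_upwards [(Metric.tendsto_nhds.1 (h R hRpos)) (ε / 3) (by positivity), ha R hRpos]
    with i hi hi2
  rw [Real.dist_eq] at hi ⊢
  have h2 := hb R hRpos
  rw [abs_sub_comm] at h2
  have h3 := abs_sub_le (a i) (a' R i) b
  have h4 := abs_sub_le (a' R i) (b' R) b
  linarith

theorem tendsto_integral_of_quadraticTail [IsFiniteMeasure μ] (hK : 0 ≤ K)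
    {F : ℕ → Ω → ℝ} (hF : ∀ n, QuadraticTail μ (F n) K) (hf : QuadraticTail μ f K)
    (hFm : ∀ n, AEStronglyMeasurable (F n) μ) (hfm : AEStronglyMeasurable f μ)
    (hlim : ∀ x, Tendsto (fun n => F n x) atTop (𝓝 (f x))) :
    Tendsto (fun n => ∫ x, F n x ∂μ) atTop (𝓝 (∫ x, f x ∂μ)) := by
  refine tendsto_of_forall_truncation hK (fun R n => ∫ x, clamp R (F n x) ∂μ)
    (fun R => ∫ x, clamp R (f x) ∂μ)
    (fun R hR => Eventually.of_forall fun n => (hF n).abs_integral_sub_le hK (hFm n) hR)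
    (fun R hR => hf.abs_integral_sub_le hK hfm hR) fun R hR => ?_
  refine tendsto_integral_of_dominated_convergence (fun _ => R)
    (fun n => (continuous_clamp R).comp_aestronglyMeasurable (hFm n)) (integrable_const R)
    (fun n => Eventually.of_forall fun x => abs_clamp_le hR.le _)
    (Eventually.of_forall fun x => ((continuous_clamp R).tendsto _).comp (hlim x))

end Tail

/-! ### Tail bounds and integrals of unbounded functions under weak convergence. -/

section WeakLimit

variable {Ω : Type*} [MeasurableSpace Ω] [TopologicalSpace Ω] [HasOuterApproxClosed Ω]
  [BorelSpace Ω] {ι : Type*} {l : Filter ι} {P : ι → ProbabilityMeasure Ω}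
  {P₀ : ProbabilityMeasure Ω} {f : Ω → ℝ} {K : ℝ}

theorem measure_le_of_tendsto_of_isOpen [l.NeBot] (hP : Tendsto P l (𝓝 P₀)) {U : Set Ω}
    (hU : IsOpen U) {c : ENNReal} (h : ∀ᶠ i in l, (P i : Measure Ω) U ≤ c) :
    (P₀ : Measure Ω) U ≤ c := by
  refine (ProbabilityMeasure.le_liminf_measure_open_of_tendsto hP hU).trans ?_
  exact liminf_le_of_le (by isBoundedDefault) fun b hb =>
    let ⟨_, h1, h2⟩ := (hb.and h).exists
    h1.trans h2

/-- The tail events are open because the inequality is strict, so the portmanteau theorem carries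
the bound to the limit. -/
theorem quadraticTail_of_tendsto [l.NeBot] (hP : Tendsto P l (𝓝 P₀)) (hf : Continuous f)
    (h : ∀ᶠ i in l, QuadraticTail (P i : Measure Ω) f K) :
    QuadraticTail (P₀ : Measure Ω) f K := fun t ht =>
  measure_le_of_tendsto_of_isOpen hP (isOpen_lt continuous_const (by fun_prop))
    (h.mono fun _ hi => hi t ht)

theorem tendsto_integral_of_tendsto_of_quadraticTail [l.NeBot] (hK : 0 ≤ K)
    (hP : Tendsto P l (𝓝 P₀)) (hf : Continuous f)
    (h : ∀ᶠ i in l, QuadraticTail (P i : Measure Ω) f K) :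
    Tendsto (fun i => ∫ x, f x ∂(P i : Measure Ω)) l (𝓝 (∫ x, f x ∂(P₀ : Measure Ω))) := by
  have hm : ∀ μ : Measure Ω, AEStronglyMeasurable f μ := fun μ =>
    hf.measurable.aestronglyMeasurable
  refine tendsto_of_forall_truncation hK (fun R i => ∫ x, clamp R (f x) ∂(P i : Measure Ω))
    (fun R => ∫ x, clamp R (f x) ∂(P₀ : Measure Ω))
    (fun R hR => h.mono fun i hi => hi.abs_integral_sub_le hK (hm _) hR)
    (fun R hR => (quadraticTail_of_tendsto hP hf h).abs_integral_sub_le hK (hm _) hR)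
    fun R hR => ?_
  let φ : BoundedContinuousFunction Ω ℝ := BoundedContinuousFunction.ofNormedAddCommGroup
    (fun x => clamp R (f x)) ((continuous_clamp R).comp hf) R fun x => abs_clamp_le hR.le _
  exact ProbabilityMeasure.tendsto_iff_forall_integral_tendsto.1 hP φ

end WeakLimit

/-! ### Absolutely continuous paths with bounded rate, and compact sets of paths -/

section Lipschitz

variable {T : ℝ} {E : Type} [NormedAddCommGroup E] [NormedSpace ℝ E]

/-- A norming functional for `f v - f u` reduces the claim to a real-valued absolutely continuous
function, which is the integral of its derivative. -/
theorem IsACWithRate.dist_le {hT : 0 < T} {L : ℝ} {f : C(Set.Icc (0 : ℝ) T, E)}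
    (h : IsACWithRate hT L f) (u v : Set.Icc (0 : ℝ) T) : dist (f u) (f v) ≤ L * dist u v := by
  have main : ∀ u v : Set.Icc (0 : ℝ) T, u ≤ v → ‖f v - f u‖ ≤ L * (v - u) := by
    intro u v huv
    have huv' : (u : ℝ) ≤ v := huv
    obtain ⟨φ, hφ1, hφ⟩ := exists_dual_vector'' ℝ (f v - f u)
    set g : ℝ → ℝ := fun s => φ (Set.IccExtend hT.le f s) with hg
    have hsub : Set.uIcc (u : ℝ) v ⊆ Set.uIcc 0 T := by
      rw [Set.uIcc_of_le huv', Set.uIcc_of_le hT.le]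
      exact Set.Icc_subset_Icc u.2.1 v.2.2
    have hac : AbsolutelyContinuousOnInterval g u v := by
      have h0 : AbsolutelyContinuousOnInterval g 0 T := by
        have := h.1
        rw [absolutelyContinuousOnInterval_iff] at this ⊢
        intro ε hε
        obtain ⟨δ, hδ, hδ'⟩ := this ε hε
        refine ⟨δ, hδ, fun I hI hlen => lt_of_le_of_lt (Finset.sum_le_sum fun i _ => ?_)
          (hδ' I hI hlen)⟩
        rw [dist_eq_norm, dist_eq_norm, ← map_sub]
        exact (φ.le_of_opNorm_le hφ1 _).trans (by rw [one_mul])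
      exact h0.mono hsub
    have hint := hac.integral_deriv_eq_sub
    have hgu : g u = φ (f u) := by simp [hg, Set.IccExtend_val]
    have hgv : g v = φ (f v) := by simp [hg, Set.IccExtend_val]
    have hae : ∀ᵐ s, s ∈ Set.uIoc (u : ℝ) v → ‖deriv g s‖ ≤ L := by
      have h2 := (ae_restrict_iff' measurableSet_Icc).1 h.2
      filter_upwards [h2] with s hs hsuv
      rw [Set.uIoc_of_le huv'] at hsuv
      obtain ⟨w, hw, hwL⟩ := hs ⟨u.2.1.trans hsuv.1.le, hsuv.2.trans v.2.2⟩
      have hd : HasDerivAt g (φ w) s := φ.hasFDerivAt.comp_hasDerivAt s hw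
      rw [hd.deriv]
      exact ((φ.le_of_opNorm_le hφ1 _).trans (by rw [one_mul])).trans hwL
    have hb := intervalIntegral.norm_integral_le_of_norm_le_const_ae hae
    rw [hint, hgu, hgv, ← map_sub, hφ, abs_of_nonneg (sub_nonneg.2 huv')] at hb
    simpa using hb
  rcases le_total u v with huv | huv
  · have h1 : (u : ℝ) ≤ v := huv
    rw [dist_comm, dist_eq_norm, dist_comm, Subtype.dist_eq, Real.dist_eq,
      abs_of_nonneg (sub_nonneg.2 h1)]
    exact main u v huv
  · have h1 : (v : ℝ) ≤ u := huv
    rw [dist_eq_norm, Subtype.dist_eq, Real.dist_eq, abs_of_nonneg (sub_nonneg.2 h1)]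
    exact main v u huv

/-- The converse is Rademacher's theorem. The Lipschitz form only involves evaluations, so it is
stable under limits of paths. -/
theorem isACWithRate_iff [FiniteDimensional ℝ E] {hT : 0 < T} {L : ℝ} (hL : 0 ≤ L)
    {f : C(Set.Icc (0 : ℝ) T, E)} :
    IsACWithRate hT L f ↔ ∀ u v, dist (f u) (f v) ≤ L * dist u v := by
  refine ⟨fun h => h.dist_le, fun h => ?_⟩
  have hlip : LipschitzWith L.toNNReal f :=
    LipschitzWith.of_dist_le_mul fun u v => by rw [Real.coe_toNNReal L hL]; exact h u v
  have hext : LipschitzWith L.toNNReal (Set.IccExtend hT.le f) := by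
    have := hlip.comp (LipschitzWith.projIcc hT.le)
    rwa [mul_one] at this
  refine ⟨hext.lipschitzOnWith.absolutelyContinuousOnInterval, ae_restrict_of_ae ?_⟩
  filter_upwards [hext.ae_differentiableAt (μ := volume)] with s hs
  refine ⟨_, hs.hasDerivAt, ?_⟩
  have := norm_deriv_le_of_lipschitz (x₀ := s) hext
  rwa [Real.coe_toNNReal L hL] at this

end Lipschitz

section Closed

variable {m : ℕ} {T : ℝ}

theorem continuous_pathB : Continuous (pathB : Enlarged m T → _) := by
  unfold pathB; fun_prop

theorem continuous_pathA : Continuous (pathA : Enlarged m T → _) := by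
  unfold pathA; fun_prop

theorem continuous_pathM : Continuous (pathM : Enlarged m T → _) := by
  unfold pathM; fun_prop

theorem continuous_pathQ : Continuous (pathQ : Enlarged m T → _) := by
  unfold pathQ; fun_prop

theorem isClosed_enlargedL (hT : 0 < T) {L : ℝ} (hL : 0 ≤ L) :
    IsClosed (enlargedL m hT L) := by
  have e : enlargedL m hT L = {x | pathB x = pathA x + pathM x} ∩
      ({x | ∀ u v, dist (pathA x u) (pathA x v) ≤ L * dist u v} ∩
        {x | ∀ u v, dist (pathQ x u) (pathQ x v) ≤ L * dist u v}) := by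
    ext x
    simp only [enlargedL, isACWithRate_iff hL, Set.mem_inter_iff, Set.mem_ofPred_eq]
  have hA := continuous_pathA (m := m) (T := T)
  have hQ := continuous_pathQ (m := m) (T := T)
  rw [e]
  refine (isClosed_eq continuous_pathB (hA.add continuous_pathM)).inter
    (IsClosed.inter ?_ ?_)
  · simp only [Set.ofPred_forall]
    refine isClosed_iInter fun u => isClosed_iInter fun v => isClosed_le ?_ continuous_const
    exact ((continuous_eval_const u).comp hA).dist ((continuous_eval_const v).comp hA)
  · simp only [Set.ofPred_forall]
    refine isClosed_iInter fun u => isClosed_iInter fun v => isClosed_le ?_ continuous_const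
    exact ((continuous_eval_const u).comp hQ).dist ((continuous_eval_const v).comp hQ)

theorem dist_coord_le {x : Enlarged m T} {hT : 0 < T} {L : ℝ} (hx : x ∈ enlargedL m hT L)
    (i j : Fin m) (u v : Set.Icc (0 : ℝ) T) :
    |(pathQ x u).1 i j - (pathQ x v).1 i j| ≤ L * dist u v := by
  refine le_trans ?_ (hx.2.2.dist_le u v)
  rw [dist_eq_norm]
  have h1 := norm_le_pi_norm (((pathQ x u - pathQ x v : SymMat m) : Fin m → Fin m → ℝ) i) j
  have h2 := norm_le_pi_norm ((pathQ x u - pathQ x v : SymMat m) : Fin m → Fin m → ℝ) i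
  exact h1.trans h2

end Closed

section Compact

variable {T : ℝ} {E : Type} [NormedAddCommGroup E]

/-- The paths whose oscillation over times at distance at most `δ j` is at most `1 / (j + 1)`. -/
def modulusSet (T : ℝ) (E : Type) [NormedAddCommGroup E] (δ : ℕ → ℝ) : Set (PathSpace T E) :=
  {ω | ∀ j u v, dist u v ≤ δ j → dist (ω.1 u) (ω.1 v) ≤ 1 / ((j : ℝ) + 1)}

/-- Going back to time `0`, where the path vanishes, in steps of length `δ 0` changes the path by at
most `1` per step. -/
theorem norm_le_of_mem_modulusSet {δ : ℕ → ℝ} {ω : PathSpace T E} (hω : ω ∈ modulusSet T E δ)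
    (hδ : 0 < δ 0) (n : ℕ) (u : Set.Icc (0 : ℝ) T) (hu : (u : ℝ) ≤ n * δ 0) : ‖ω.1 u‖ ≤ n := by
  induction n generalizing u with
  | zero =>
    have h0 : (u : ℝ) = 0 := le_antisymm (by simpa using hu) u.2.1
    rw [ω.2 u h0]; simp
  | succ n ih =>
    let v : Set.Icc (0 : ℝ) T := ⟨max 0 (u - δ 0), le_max_left _ _,
      max_le (u.2.1.trans u.2.2) (by linarith [u.2.2])⟩
    have hv : (v : ℝ) ≤ n * δ 0 := max_le (by positivity) (by push_cast at hu; linarith)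
    have hd : dist u v ≤ δ 0 := by
      rw [Subtype.dist_eq, Real.dist_eq]
      have h1 : (v : ℝ) ≤ u := max_le u.2.1 (by linarith)
      have h2 : (u : ℝ) - δ 0 ≤ v := le_max_right _ _
      rw [abs_of_nonneg (by linarith)]; linarith
    have h1 := hω 0 u v hd
    have h2 := ih v hv
    rw [dist_eq_norm] at h1
    have h3 := norm_sub_norm_le (ω.1 u) (ω.1 v)
    push_cast at h1 ⊢
    norm_num at h1
    linarith

/-- Arzelà–Ascoli: the set is closed, equicontinuous by definition, and bounded by the previous
lemma. -/
theorem isCompact_modulusSet [ProperSpace E] {δ : ℕ → ℝ} (hδ : ∀ j, 0 < δ j) :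
    IsCompact (modulusSet T E δ) := by
  let S : Set C(Set.Icc (0 : ℝ) T, E) := Subtype.val '' modulusSet T E δ
  suffices hS : IsCompact S from Topology.IsInducing.subtypeVal.isCompact_iff.2 hS
  obtain ⟨n, hn⟩ := exists_nat_gt (T / δ 0)
  rw [div_lt_iff₀ (hδ 0)] at hn
  have hSeq : S = {f | (∀ s : Set.Icc (0 : ℝ) T, (s : ℝ) = 0 → f s = 0) ∧
      ∀ j u v, dist u v ≤ δ j → dist (f u) (f v) ≤ 1 / ((j : ℝ) + 1)} := by
    ext f
    constructor
    · rintro ⟨ω, hω, rfl⟩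
      exact ⟨ω.2, hω⟩
    · rintro ⟨h1, h2⟩
      exact ⟨⟨f, h1⟩, h2, rfl⟩
  have hcl : IsClosed S := by
    rw [hSeq]
    simp only [Set.ofPred_and, Set.ofPred_forall]
    refine IsClosed.inter ?_ ?_
    · exact isClosed_iInter fun s => isClosed_iInter fun _ =>
        isClosed_eq (continuous_eval_const s) continuous_const
    · exact isClosed_iInter fun j => isClosed_iInter fun u => isClosed_iInter fun v =>
        isClosed_iInter fun _ => isClosed_le
          ((continuous_eval_const u).dist (continuous_eval_const v)) continuous_const
  let e : C(Set.Icc (0 : ℝ) T, E) ≃ₜ BoundedContinuousFunction (Set.Icc (0 : ℝ) T) E :=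
    (ContinuousMap.isometryEquivBoundedOfCompact (Set.Icc (0 : ℝ) T) E).toHomeomorph
  have himg : IsCompact (e '' S) := by
    refine BoundedContinuousFunction.arzela_ascoli₂ (Metric.closedBall 0 n)
      (isCompact_closedBall _ _) _ ?_ ?_ ?_
    · exact e.isClosedMap _ hcl
    · rintro _ x ⟨f, ⟨ω, hω, rfl⟩, rfl⟩
      rw [mem_closedBall_zero_iff]
      exact norm_le_of_mem_modulusSet hω (hδ 0) n x (x.2.2.trans hn.le)
    · intro u
      rw [Metric.equicontinuousAt_iff]
      intro ε hε
      obtain ⟨j, hj⟩ := exists_nat_one_div_lt hε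
      refine ⟨δ j, hδ j, ?_⟩
      rintro v hv ⟨_, f, ⟨ω, hω, rfl⟩, rfl⟩
      refine lt_of_le_of_lt (hω j u v ?_) hj
      rw [dist_comm]; exact hv.le
  exact e.isCompact_image.1 himg

end Compact

/-! ### Increments of square-integrable martingales -/

section Increments

variable {Ω : Type*} {m0 : MeasurableSpace Ω} {μ : Measure Ω}

theorem martingale_euclidean_iff {ι : Type*} [Preorder ι] {n : ℕ} {𝓕 : Filtration ι m0}
    {M : ι → Ω → Vec n} :
    Martingale M 𝓕 μ ↔ ∀ i, Martingale (fun t x => M t x i) 𝓕 μ := by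
  constructor
  · intro h i
    refine ⟨fun t => (EuclideanSpace.proj i : Vec n →L[ℝ] ℝ).continuous.comp_stronglyMeasurable
      (h.stronglyAdapted t), fun s t hst => ?_⟩
    have h1 := (EuclideanSpace.proj i : Vec n →L[ℝ] ℝ).comp_condExp_comm
      (m := 𝓕 s) (h.integrable t)
    filter_upwards [h1, h.condExp_ae_eq hst] with x hx1 hx2
    simp only [Function.comp_def] at hx1
    rw [hx2] at hx1
    exact hx1.symm
  · intro h
    have hint : ∀ t, Integrable (M t) μ := fun t =>
      Integrable.of_eval_piLp fun i => (h i).integrable t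
    refine ⟨fun t => ?_, fun s t hst => ?_⟩
    · have h1 : Measurable[𝓕 t] fun x => (fun i => M t x i) :=
        @measurable_pi_lambda _ _ _ (𝓕 t) _ _ fun i => ((h i).stronglyAdapted t).measurable
      exact ((PiLp.continuous_toLp 2 fun _ : Fin n => ℝ).measurable.comp h1).stronglyMeasurable
    · have h1 : ∀ᵐ x ∂μ, ∀ i, (μ[M t|𝓕 s]) x i = M s x i := by
        refine ae_all_iff.2 fun i => ?_
        have h1 := (EuclideanSpace.proj i : Vec n →L[ℝ] ℝ).comp_condExp_comm
          (m := 𝓕 s) (hint t)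
        filter_upwards [h1, (h i).condExp_ae_eq hst] with x hx1 hx2
        exact hx1.trans hx2
      filter_upwards [h1] with x hx
      ext i
      exact hx i

variable [IsProbabilityMeasure μ]

theorem integral_mul_sub_eq_zero {ι : Type*} [Preorder ι] {𝓕 : Filtration ι m0}
    {X : ι → Ω → ℝ} (hX : Martingale X 𝓕 μ) {r t : ι} (hrt : r ≤ t)
    {Z : Ω → ℝ} (hZ : StronglyMeasurable[𝓕 r] Z) (hint : Integrable (Z * (X t - X r)) μ) :
    ∫ x, Z x * (X t x - X r x) ∂μ = 0 := by
  have h1 := condExp_mul_of_stronglyMeasurable_left hZ hint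
    ((hX.integrable t).sub (hX.integrable r))
  have h2 : μ[X t - X r|𝓕 r] =ᵐ[μ] 0 := by
    filter_upwards [condExp_sub (hX.integrable t) (hX.integrable r) (𝓕 r),
      hX.condExp_ae_eq hrt, hX.condExp_ae_eq (le_refl r)] with x e1 e2 e3
    rw [e1, Pi.sub_apply, e2, e3, sub_self, Pi.zero_apply]
  change ∫ x, (Z * (X t - X r)) x ∂μ = 0
  rw [← integral_condExp (𝓕.le r), integral_congr_ae h1]
  refine integral_eq_zero_of_ae ?_
  filter_upwards [h2] with x hx
  simp [hx]

theorem setIntegral_mul_sub_eq_zero {ι : Type*} [Preorder ι] {𝓕 : Filtration ι m0}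
    {X : ι → Ω → ℝ} (hX : Martingale X 𝓕 μ) (hX2 : ∀ t, MemLp (X t) 2 μ) {r t : ι} (hrt : r ≤ t)
    {Z : Ω → ℝ} (hZ : StronglyMeasurable[𝓕 r] Z) (hZ2 : MemLp Z 2 μ) {G : Set Ω}
    (hG : MeasurableSet[𝓕 r] G) : ∫ x in G, Z x * (X t x - X r x) ∂μ = 0 := by
  have hG0 := 𝓕.le r _ hG
  have h0 := integral_mul_sub_eq_zero hX hrt (hZ.indicator hG)
    ((hZ2.indicator hG0).integrable_mul ((hX2 t).sub (hX2 r)))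
  rw [← integral_indicator hG0, ← h0]
  congr 1
  funext x
  by_cases hx : x ∈ G <;> simp [hx]

variable {T : ℝ} {𝓕 : Filtration (Set.Icc (0 : ℝ) T) m0} {X q : Set.Icc (0 : ℝ) T → Ω → ℝ} {C : ℝ}

/-- Orthogonality of increments gives the submartingale part. It also turns the second moment of `X
t - X s` on an event of `𝓕 s` into the mean of `q t - q s` there, which is at most `C * (t - s)`
times the measure of the event. -/
theorem linearIncrementBound_of_martingale (hX : Martingale X 𝓕 μ) (hX2 : ∀ t, MemLp (X t) 2 μ)
    (hq : Martingale (fun t x => X t x * X t x - q t x) 𝓕 μ)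
    (hqC : ∀ᵐ x ∂μ, ∀ s t, s ≤ t → q t x - q s x ≤ C * (t - s)) :
    LinearIncrementBound μ 𝓕 X C := by
  have hsq : ∀ s t, Integrable (fun x => (X t x - X s x) ^ 2) μ := fun s t =>
    ((hX2 t).sub (hX2 s)).integrable_sq
  have hmul : ∀ s t r, Integrable (fun x => X s x * (X t x - X r x)) μ := fun s t r =>
    (hX2 s).integrable_mul ((hX2 t).sub (hX2 r))
  have hmul' : ∀ s s' t r, Integrable (fun x => (X s x - X s' x) * (X t x - X r x)) μ :=
    fun s s' t r => ((hX2 s).sub (hX2 s')).integrable_mul ((hX2 t).sub (hX2 r))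
  have hlin : ∀ (s t) (G : Set Ω), ∫⁻ x in G, ENNReal.ofReal ((X t x - X s x) ^ 2) ∂μ =
      ENNReal.ofReal (∫ x in G, (X t x - X s x) ^ 2 ∂μ) := fun s t G =>
    (ofReal_integral_eq_lintegral_ofReal (hsq s t).integrableOn
      (Eventually.of_forall fun x => sq_nonneg _)).symm
  constructor
  · intro s r t hsr hrt G hG
    rw [hlin, hlin]
    apply ENNReal.ofReal_le_ofReal
    have hZ : StronglyMeasurable[𝓕 r] (X r - X s) :=
      (hX.stronglyAdapted r).sub ((hX.stronglyAdapted s).mono (𝓕.mono hsr))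
    have h0 : ∫ x in G, (X r x - X s x) * (X t x - X r x) ∂μ = 0 :=
      setIntegral_mul_sub_eq_zero hX hX2 hrt hZ ((hX2 r).sub (hX2 s)) hG
    have e : ∀ x, (X t x - X s x) ^ 2 = (X r x - X s x) ^ 2 +
        (2 * ((X r x - X s x) * (X t x - X r x)) + (X t x - X r x) ^ 2) := fun x => by ring
    have hnn : 0 ≤ ∫ x in G, (X t x - X r x) ^ 2 ∂μ := integral_nonneg fun x => sq_nonneg _
    have hi : Integrable (fun x => 2 * ((X r x - X s x) * (X t x - X r x)) +
        (X t x - X r x) ^ 2) μ := ((hmul' r s t r).const_mul 2).add (hsq r t)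
    simp only [e]
    rw [integral_add (hsq s r).integrableOn hi.integrableOn,
      integral_add ((hmul' r s t r).const_mul 2).integrableOn (hsq r t).integrableOn,
      integral_const_mul, h0]
    linarith
  · intro s t hst G hG
    have hG0 := 𝓕.le s _ hG
    have hqint : ∀ t, Integrable (q t) μ := fun t => by
      have h1 : Integrable (fun x => X t x * X t x) μ := (hX2 t).integrable_mul (hX2 t)
      exact (h1.sub (hq.integrable t)).congr (Eventually.of_forall fun x => by simp)
    have h0 : ∫ x in G, X s x * (X t x - X s x) ∂μ = 0 :=
      setIntegral_mul_sub_eq_zero hX hX2 hst (hX.stronglyAdapted s) (hX2 s) hG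
    have h1 := hq.setIntegral_eq hst hG
    have e : ∀ x, (X t x - X s x) ^ 2 = (((X t x * X t x - q t x) - (X s x * X s x - q s x)) +
        (q t x - q s x)) - 2 * (X s x * (X t x - X s x)) := fun x => by ring
    have hi1 : Integrable (fun x => (X t x * X t x - q t x) - (X s x * X s x - q s x)) μ :=
      (hq.integrable t).sub (hq.integrable s)
    have hi2 : Integrable (fun x => q t x - q s x) μ := (hqint t).sub (hqint s)
    have hi3 : Integrable (fun x => ((X t x * X t x - q t x) - (X s x * X s x - q s x)) +
        (q t x - q s x)) μ := hi1.add hi2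
    have hval : ∫ x in G, (X t x - X s x) ^ 2 ∂μ = ∫ x in G, (q t x - q s x) ∂μ := by
      simp only [e]
      rw [integral_sub hi3.integrableOn ((hmul s t s).const_mul 2).integrableOn,
        integral_add hi1.integrableOn hi2.integrableOn,
        integral_sub (hq.integrable t).integrableOn (hq.integrable s).integrableOn, h1,
        integral_const_mul, h0]
      ring
    have hle : ∫ x in G, (q t x - q s x) ∂μ ≤ C * (t - s) * μ.real G := by
      calc ∫ x in G, (q t x - q s x) ∂μ ≤ ∫ x in G, C * ((t : ℝ) - s) ∂μ := by
            refine integral_mono_ae hi2.integrableOn (integrable_const _) (ae_restrict_of_ae ?_)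
            filter_upwards [hqC] with x hx using hx s t hst
        _ = _ := by rw [setIntegral_const, smul_eq_mul, mul_comm]
    rw [hlin, hval]
    refine (ENNReal.ofReal_le_ofReal hle).trans ?_
    rw [ENNReal.ofReal_mul' measureReal_nonneg, ofReal_measureReal]

theorem quadraticTail_of_ae_abs_le {f : Ω → ℝ} {B : ℝ} (h : ∀ᵐ x ∂μ, |f x| ≤ B) :
    QuadraticTail μ f (B ^ 2) := by
  intro t ht
  rcases le_or_gt B t with hBt | hBt
  · have h0 : μ {x | t < |f x|} = 0 := by
      refine measure_mono_null ?_ h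
      intro x (hx : t < |f x|) (hx' : |f x| ≤ B)
      linarith
    rw [h0]; exact zero_le
  · refine prob_le_one.trans ?_
    rw [← ENNReal.ofReal_one]
    apply ENNReal.ofReal_le_ofReal
    rw [le_div_iff₀ (by positivity)]
    nlinarith

theorem LinearIncrementBound.measure_gt_le (h : LinearIncrementBound μ 𝓕 X C) (hC : 0 ≤ C)
    (hX : ∀ t, Measurable[𝓕 t] (X t)) (hXc : ∀ x, Continuous fun t => X t x)
    (hX0 : ∀ x, ∀ t : Set.Icc (0 : ℝ) T, (t : ℝ) = 0 → X t x = 0) (t : Set.Icc (0 : ℝ) T) {l : ℝ}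
    (hl : 0 < l) : μ {x | l < |X t x|} ≤ ENNReal.ofReal (81 * (C * T) ^ 2 / l ^ 4) := by
  let a : Set.Icc (0 : ℝ) T := ⟨0, le_rfl, t.2.1.trans t.2.2⟩
  have hat : a ≤ t := t.2.1
  -- The level `l / 3` turns the factor `3` into `3 ^ 4 = 81`.
  have h1 := h.measure_exists_abs_sub_gt_le hC hX hXc hat (l := l / 3) (by positivity)
  refine (measure_mono ?_).trans (h1.trans (ENNReal.ofReal_le_ofReal ?_))
  · intro x (hx : l < |X t x|)
    refine ⟨t, hat, le_rfl, ?_⟩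
    rw [hX0 x a rfl, sub_zero]
    linarith
  · have h2 : C * ((t : ℝ) - a) ≤ C * T := by
      have := t.2.2
      simp only [a, sub_zero]; gcongr
    have h3 : 0 ≤ C * ((t : ℝ) - a) := by
      have := t.2.1
      simp only [a, sub_zero]; positivity
    calc (C * ((t : ℝ) - a)) ^ 2 / (l / 3) ^ 4 ≤ (C * T) ^ 2 / (l / 3) ^ 4 := by gcongr
      _ = _ := by field_simp; norm_num

theorem LinearIncrementBound.quadraticTail_sq (h : LinearIncrementBound μ 𝓕 X C) (hC : 0 ≤ C)
    (hX : ∀ t, Measurable[𝓕 t] (X t)) (hXc : ∀ x, Continuous fun t => X t x)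
    (hX0 : ∀ x, ∀ t : Set.Icc (0 : ℝ) T, (t : ℝ) = 0 → X t x = 0) (t : Set.Icc (0 : ℝ) T) :
    QuadraticTail μ (fun x => X t x ^ 2) (81 * (C * T) ^ 2) := by
  intro l hl
  have h1 := h.measure_gt_le hC hX hXc hX0 t (l := √l) (Real.sqrt_pos.2 hl)
  have e : √l ^ 4 = l ^ 2 := by
    rw [show (4 : ℕ) = 2 * 2 from rfl, pow_mul, Real.sq_sqrt hl.le]
  rw [e] at h1
  refine (measure_mono ?_).trans h1
  intro x (hx : l < |X t x ^ 2|)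
  change √l < |X t x|
  rw [abs_pow] at hx
  exact (Real.sqrt_lt' (lt_of_le_of_ne (abs_nonneg _) (by
    rintro h0; rw [← h0] at hx; norm_num at hx; linarith))).2 hx

/-- With `y = 9 * (C * T) / l ^ 2` the fourth-order bound is `y ^ 2`, and a probability at most `y ^
2` is at most `y`: either `y ≥ 1`, or `y ^ 2 ≤ y`. -/
theorem LinearIncrementBound.quadraticTail (h : LinearIncrementBound μ 𝓕 X C) (hC : 0 ≤ C)
    (hX : ∀ t, Measurable[𝓕 t] (X t)) (hXc : ∀ x, Continuous fun t => X t x)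
    (hX0 : ∀ x, ∀ t : Set.Icc (0 : ℝ) T, (t : ℝ) = 0 → X t x = 0) (t : Set.Icc (0 : ℝ) T) :
    QuadraticTail μ (X t) (9 * (C * T)) := by
  intro l hl
  have hT : 0 ≤ T := t.2.1.trans t.2.2
  rcases le_or_gt 1 (9 * (C * T) / l ^ 2) with h1 | h1
  · refine prob_le_one.trans ?_
    rw [← ENNReal.ofReal_one]
    exact ENNReal.ofReal_le_ofReal h1
  · refine (h.measure_gt_le hC hX hXc hX0 t hl).trans (ENNReal.ofReal_le_ofReal ?_)
    have e : 81 * (C * T) ^ 2 / l ^ 4 = (9 * (C * T) / l ^ 2) ^ 2 := by field_simp; ring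
    have h0 : 0 ≤ 9 * (C * T) / l ^ 2 := by positivity
    rw [e]
    nlinarith

end Increments

/-! ### Stopping the canonical paths -/

section Stopping

variable {T : ℝ} {m : ℕ} {E : Type} [NormedAddCommGroup E]

/-- The path `ω` stopped at time `r`. -/
def stopPath (r : Set.Icc (0 : ℝ) T) (ω : PathSpace T E) : PathSpace T E :=
  ⟨ω.1.comp ⟨fun u => min u r, by fun_prop⟩, fun u hu => ω.2 _ <| by
    have h1 : min u r ≤ u := min_le_left _ _
    have h2 : ((min u r : Set.Icc (0 : ℝ) T) : ℝ) ≤ u := h1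
    exact le_antisymm (h2.trans hu.le) (min u r).2.1⟩

theorem stopPath_apply (r : Set.Icc (0 : ℝ) T) (ω : PathSpace T E) (u : Set.Icc (0 : ℝ) T) :
    (stopPath r ω).1 u = ω.1 (min u r) := rfl

theorem continuous_stopPath (r : Set.Icc (0 : ℝ) T) :
    Continuous (stopPath r : PathSpace T E → PathSpace T E) :=
  Continuous.subtype_mk ((ContinuousMap.continuous_precomp _).comp continuous_subtype_val) _

theorem measurable_pathSpace_iff [MeasurableSpace E] {Ω : Type*} {m0 : MeasurableSpace Ω}
    {f : Ω → PathSpace T E} : Measurable f ↔ ∀ u, Measurable fun x => (f x).1 u := by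
  constructor
  · intro h u
    exact (measurable_eval u).comp (measurable_subtype_coe.comp h)
  · intro h
    refine Measurable.of_comap_le ?_
    simp only [instMeasurableSpaceContinuousMap, Subtype.instMeasurableSpace,
      MeasurableSpace.comap_iSup, MeasurableSpace.comap_comp]
    exact iSup_le fun u => (h u).comap_le

theorem measurable_stopPath [MeasurableSpace E] (r : Set.Icc (0 : ℝ) T) :
    Measurable[pathSigma E r] (stopPath r : PathSpace T E → PathSpace T E) := by
  refine (@measurable_pathSpace_iff T E _ _ _ (pathSigma E r) _).2 fun u => ?_
  refine Measurable.of_comap_le (le_iSup₂_of_le (min u r) (min_le_right _ _) le_rfl)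

theorem measurable_min_timeSigma (r : Set.Icc (0 : ℝ) T) :
    Measurable[timeSigma r] fun u : Set.Icc (0 : ℝ) T => min u r := by
  refine @measurable_of_Iic _ _ _ _ _ (timeSigma r) _ _ _ _ fun a => ?_
  rcases le_or_gt r a with h | h
  · have : (fun u : Set.Icc (0 : ℝ) T => min u r) ⁻¹' Set.Iic a = Set.univ := by
      ext u; simp [h]
    rw [this]; exact @MeasurableSet.univ _ (timeSigma r)
  · have : (fun u : Set.Icc (0 : ℝ) T => min u r) ⁻¹' Set.Iic a = Set.Iic a := by
      ext u; simp [h]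
    rw [this]
    exact MeasurableSpace.measurableSet_generateFrom ⟨a, h.le, rfl⟩

/-- The point of the canonical space with all components stopped at time `r`. -/
def stopAll (r : Set.Icc (0 : ℝ) T) (x : Enlarged m T) : Enlarged m T :=
  ((min x.1.1 r, stopPath r x.1.2), stopPath r x.2.1, stopPath r x.2.2.1, stopPath r x.2.2.2)

theorem continuous_stopAll (r : Set.Icc (0 : ℝ) T) :
    Continuous (stopAll r : Enlarged m T → Enlarged m T) := by
  have h1 := continuous_stopPath (E := Vec m) r
  have h2 := continuous_stopPath (E := SymMat m) r
  unfold stopAll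
  fun_prop

theorem measurable_stopAll (r : Set.Icc (0 : ℝ) T) :
    Measurable[sigmaG r] (stopAll r : Enlarged m T → Enlarged m T) := by
  have hfst : ∀ {α β : Type} (a : MeasurableSpace α) (b : MeasurableSpace β),
      Measurable[a.prod b, a] (Prod.fst : α × β → α) := fun a b => @measurable_fst _ _ a b
  have hsnd : ∀ {α β : Type} (a : MeasurableSpace α) (b : MeasurableSpace β),
      Measurable[a.prod b, b] (Prod.snd : α × β → β) := fun a b => @measurable_snd _ _ a b
  have h1 := (measurable_min_timeSigma r).comp ((hfst _ _).comp (hfst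
    ((timeSigma r).prod (pathSigma (Vec m) r))
    ((pathSigma (Vec m) r).prod ((pathSigma (Vec m) r).prod (pathSigma (SymMat m) r)))))
  have h2 := (measurable_stopPath (E := Vec m) r).comp ((hsnd _ _).comp (hfst
    ((timeSigma r).prod (pathSigma (Vec m) r))
    ((pathSigma (Vec m) r).prod ((pathSigma (Vec m) r).prod (pathSigma (SymMat m) r)))))
  have h3 := (measurable_stopPath (E := Vec m) r).comp ((hfst _ _).comp (hsnd
    ((timeSigma r).prod (pathSigma (Vec m) r))
    ((pathSigma (Vec m) r).prod ((pathSigma (Vec m) r).prod (pathSigma (SymMat m) r)))))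
  have h4 := (measurable_stopPath (E := Vec m) r).comp ((hfst _ _).comp ((hsnd _ _).comp (hsnd
    ((timeSigma r).prod (pathSigma (Vec m) r))
    ((pathSigma (Vec m) r).prod ((pathSigma (Vec m) r).prod (pathSigma (SymMat m) r))))))
  have h5 := (measurable_stopPath (E := SymMat m) r).comp ((hsnd _ _).comp ((hsnd _ _).comp (hsnd
    ((timeSigma r).prod (pathSigma (Vec m) r))
    ((pathSigma (Vec m) r).prod ((pathSigma (Vec m) r).prod (pathSigma (SymMat m) r))))))
  exact (h1.prodMk h2).prodMk (h3.prodMk (h4.prodMk h5))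

theorem measurable_pathSigma_of_stopPath [MeasurableSpace E] {Ω : Type*} {m0 : MeasurableSpace Ω}
    {s r : Set.Icc (0 : ℝ) T} (hsr : s ≤ r) {f : Ω → PathSpace T E}
    (hf : Measurable fun x => stopPath r (f x)) : Measurable[m0, pathSigma E s] f := by
  refine Measurable.of_comap_le ?_
  simp only [MeasurableSpace.comap_iSup, MeasurableSpace.comap_comp]
  refine iSup₂_le fun u hu => Measurable.comap_le ?_
  have h1 := measurable_pathSpace_iff.1 hf u
  simp only [stopPath_apply, min_eq_left (hu.trans hsr)] at h1
  exact h1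

/-- Strictness of `s < r` matters: `min (f x) r ≤ r` always holds, so the event `f x ≤ r` cannot be
recovered, whereas `f x ≤ a` can for every `a < r`. -/
theorem measurable_timeSigma_of_min {Ω : Type*} {m0 : MeasurableSpace Ω}
    {s r : Set.Icc (0 : ℝ) T} (hsr : s < r) {f : Ω → Set.Icc (0 : ℝ) T}
    (hf : Measurable fun x => min (f x) r) : Measurable[m0, timeSigma s] f := by
  refine measurable_generateFrom ?_
  rintro _ ⟨a, ha, rfl⟩
  have e : f ⁻¹' Set.Iic a = (fun x => min (f x) r) ⁻¹' Set.Iic a := by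
    ext x; simp [not_le.2 (lt_of_le_of_lt ha hsr)]
  rw [e]
  exact hf measurableSet_Iic

theorem measurable_sigmaG_of_stopAll {Ω : Type*} {m0 : MeasurableSpace Ω}
    {s r : Set.Icc (0 : ℝ) T} (hsr : s < r) {f : Ω → Enlarged m T}
    (h : Measurable fun x => stopAll r (f x)) : Measurable[m0, sigmaG s] f := by
  have h1 : Measurable[m0, timeSigma s] fun x => (f x).1.1 :=
    measurable_timeSigma_of_min hsr (measurable_fst.comp (measurable_fst.comp h))
  have h2 : Measurable[m0, pathSigma (Vec m) s] fun x => (f x).1.2 :=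
    measurable_pathSigma_of_stopPath hsr.le (measurable_snd.comp (measurable_fst.comp h))
  have h3 : Measurable[m0, pathSigma (Vec m) s] fun x => (f x).2.1 :=
    measurable_pathSigma_of_stopPath hsr.le (measurable_fst.comp (measurable_snd.comp h))
  have h4 : Measurable[m0, pathSigma (Vec m) s] fun x => (f x).2.2.1 :=
    measurable_pathSigma_of_stopPath hsr.le
      (measurable_fst.comp (measurable_snd.comp (measurable_snd.comp h)))
  have h5 : Measurable[m0, pathSigma (SymMat m) s] fun x => (f x).2.2.2 :=
    measurable_pathSigma_of_stopPath hsr.le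
      (measurable_snd.comp (measurable_snd.comp (measurable_snd.comp h)))
  exact (h1.prodMk h2).prodMk (h3.prodMk (h4.prodMk h5))

/-- Events of `𝒢_s` are thus preimages of Borel sets under the continuous map `stopAll r`, and can
be tested by continuous functions of the stopped point. -/
theorem sigmaG_le_comap_stopAll {s r : Set.Icc (0 : ℝ) T} (hsr : s < r) :
    (sigmaG s : MeasurableSpace (Enlarged m T)) ≤
      MeasurableSpace.comap (stopAll r) inferInstance := fun _ hS =>
  measurable_sigmaG_of_stopAll (f := id) hsr
    (comap_measurable (stopAll r : Enlarged m T → Enlarged m T)) hS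

end Stopping

/-! ### From continuous test functions to events. -/

section SetIntegral

/-- The positive and negative parts of `D` are densities of two finite measures; their images under
`S` integrate every bounded continuous function equally, so they coincide. -/
theorem setIntegral_preimage_eq_zero {Ω Ω' : Type*} [MeasurableSpace Ω] [MeasurableSpace Ω']
    [TopologicalSpace Ω'] [HasOuterApproxClosed Ω'] [BorelSpace Ω'] {μ : Measure Ω}
    {S : Ω → Ω'} (hS : Measurable S) {D : Ω → ℝ} (hDm : Measurable D) (hD : Integrable D μ)
    (h : ∀ φ : BoundedContinuousFunction Ω' ℝ, ∫ x, φ (S x) * D x ∂μ = 0) {B : Set Ω'}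
    (hB : MeasurableSet B) : ∫ x in S ⁻¹' B, D x ∂μ = 0 := by
  have hfin : ∀ D : Ω → ℝ, Integrable D μ →
      IsFiniteMeasure (μ.withDensity fun x => ENNReal.ofReal (D x)) := fun D hD =>
    isFiniteMeasure_withDensity_ofReal hD.2
  have hval : ∀ D : Ω → ℝ, Measurable D → Integrable D μ →
      ∀ φ : BoundedContinuousFunction Ω' ℝ,
      ∫ y, φ y ∂((μ.withDensity fun x => ENNReal.ofReal (D x)).map S) =
        ∫ x, φ (S x) * max (D x) 0 ∂μ := by
    intro D hDm hD φ
    rw [integral_map hS.aemeasurable φ.continuous.measurable.aestronglyMeasurable,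
      integral_withDensity_eq_integral_toReal_smul hDm.ennreal_ofReal
        (Eventually.of_forall fun x => ENNReal.ofReal_lt_top)]
    simp only [ENNReal.toReal_ofReal', smul_eq_mul, mul_comm]
  have := hfin D hD
  have := hfin (fun x => -D x) hD.neg
  have hint : ∀ D : Ω → ℝ, Measurable D → Integrable D μ →
      ∀ φ : BoundedContinuousFunction Ω' ℝ, Integrable (fun x => φ (S x) * max (D x) 0) μ := by
    intro D hDm hD φ
    exact hD.pos_part.bdd_mul (c := ‖φ‖) (φ.continuous.measurable.comp hS).aestronglyMeasurable
      (Eventually.of_forall fun x => φ.norm_coe_le_norm _)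
  have hext : (μ.withDensity fun x => ENNReal.ofReal (D x)).map S =
      (μ.withDensity fun x => ENNReal.ofReal (-D x)).map S := by
    refine ext_of_forall_integral_eq_of_IsFiniteMeasure fun φ => ?_
    rw [hval D hDm hD, hval (fun x => -D x) hDm.neg hD.neg, ← sub_eq_zero,
      ← integral_sub (hint D hDm hD φ) (hint (fun x => -D x) hDm.neg hD.neg φ)]
    refine Eq.trans ?_ (h φ)
    congr 1
    funext x
    rw [← mul_sub]
    congr 1
    rcases le_total (D x) 0 with hx | hx
    · rw [max_eq_right hx, max_eq_left (by linarith)]; ring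
    · rw [max_eq_left hx, max_eq_right (by linarith)]; ring
  have hBeq := congrArg (fun ν => ν B) hext
  simp only [Measure.map_apply hS hB, withDensity_apply _ (hS hB)] at hBeq
  rw [integral_eq_lintegral_pos_part_sub_lintegral_neg_part hD.integrableOn, hBeq, sub_self]

end SetIntegral

/-! ### Martingales under weak limits of laws. -/

section MartingaleLimit

variable {T : ℝ} {m : ℕ}

theorem martingale_of_tendsto {ι : Type*} {l : Filter ι} [l.NeBot]
    {P : ι → ProbabilityMeasure (Enlarged m T)} {P₀ : ProbabilityMeasure (Enlarged m T)}
    (hP : Tendsto P l (𝓝 P₀)) {Z : Set.Icc (0 : ℝ) T → Enlarged m T → ℝ}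
    (hZ : ∀ t, Continuous (Z t)) (hZt : ∀ x, Continuous fun t => Z t x) {K : ℝ} (hK : 0 ≤ K)
    (hmart : ∀ᶠ i in l, Martingale Z (filtrationG m T) (P i : Measure (Enlarged m T)))
    (htail : ∀ t, ∀ᶠ i in l, QuadraticTail (P i : Measure (Enlarged m T)) (Z t) K) :
    Martingale Z (filtrationG m T) (P₀ : Measure (Enlarged m T)) := by
  have hZm : ∀ (t) (μ : Measure (Enlarged m T)), AEStronglyMeasurable (Z t) μ := fun t μ =>
    (hZ t).measurable.aestronglyMeasurable
  have htail₀ : ∀ t, QuadraticTail (P₀ : Measure (Enlarged m T)) (Z t) K := fun t =>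
    quadraticTail_of_tendsto hP (hZ t) (htail t)
  have hint : ∀ t, Integrable (Z t) (P₀ : Measure (Enlarged m T)) := fun t =>
    (htail₀ t).integrable hK (hZm t _)
  obtain ⟨i₀, hi₀⟩ := hmart.exists
  -- The intermediate time `r > s` leaves room for the continuous test functions of the point
  -- stopped at `r`.
  have hstep : ∀ s r t, s < r → r ≤ t → ∀ G, MeasurableSet[sigmaG s] G →
      ∫ x in G, Z t x ∂(P₀ : Measure (Enlarged m T)) =
        ∫ x in G, Z r x ∂(P₀ : Measure (Enlarged m T)) := by
    intro s r t hsr hrt G hG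
    obtain ⟨B, hB, rfl⟩ := sigmaG_le_comap_stopAll hsr G hG
    have hc := continuous_stopAll (m := m) r
    have hz := setIntegral_preimage_eq_zero (μ := (P₀ : Measure (Enlarged m T)))
      (D := fun x => Z t x - Z r x) hc.measurable
      ((hZ t).sub (hZ r)).measurable ((hint t).sub (hint r)) (fun φ => ?_) hB
    · rw [integral_sub (hint t).integrableOn (hint r).integrableOn] at hz
      linarith
    · have hcont : Continuous fun x => φ (stopAll r x) * (Z t x - Z r x) :=
        (φ.continuous.comp hc).mul ((hZ t).sub (hZ r))
      -- The increment has tail constant `4 * (K + K)`, and `φ` is bounded by `‖φ‖ + 1`, which is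
      -- positive even for `φ = 0`.
      have hlim := tendsto_integral_of_tendsto_of_quadraticTail (K := 4 * (K + K) * (‖φ‖ + 1) ^ 2)
        (by positivity) hP hcont (by
          filter_upwards [htail t, htail r] with i h1 h2
          refine ((h1.sub h2 hK hK).const_mul (c := ‖φ‖ + 1) (by positivity)).mono fun x => ?_
          rw [abs_mul, abs_mul, abs_of_nonneg (a := ‖φ‖ + 1) (by positivity)]
          gcongr
          have := φ.norm_coe_le_norm (stopAll r x)
          rw [Real.norm_eq_abs] at this
          linarith)
      refine tendsto_nhds_unique hlim (tendsto_const_nhds.congr' ?_)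
      filter_upwards [hmart] with i hi
      refine (integral_mul_sub_eq_zero hi hrt (Z := fun x => φ (stopAll r x)) ?_ ?_).symm
      · exact (φ.continuous.measurable.comp (measurable_stopAll r)).stronglyMeasurable
      · exact ((hi.integrable t).sub (hi.integrable r)).bdd_mul (c := ‖φ‖)
          (φ.continuous.comp hc).measurable.aestronglyMeasurable
          (Eventually.of_forall fun x => φ.norm_coe_le_norm _)
  -- Time `r` now decreases to `s`: `Z` is continuous in time and its tails are uniform, so the set
  -- integrals converge.
  have hset : ∀ s t, s ≤ t → ∀ G, MeasurableSet[sigmaG s] G →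
      ∫ x in G, Z s x ∂(P₀ : Measure (Enlarged m T)) =
        ∫ x in G, Z t x ∂(P₀ : Measure (Enlarged m T)) := by
    intro s t hst G hG
    rcases hst.eq_or_lt with rfl | hlt
    · rfl
    have hlt' : (0 : ℝ) < t - s := sub_pos.2 hlt
    let r : ℕ → Set.Icc (0 : ℝ) T := fun n => gridPoint s t (n + 1) 1
    have hrc : ∀ n : ℕ, (r n : ℝ) = min (t : ℝ) (s + 1 * (t - s) / ((n + 1 : ℕ) : ℝ)) := fun n => by
      simp only [r, coe_gridPoint hst, Nat.cast_one]
    have hsr : ∀ n, s < r n := by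
      intro n
      change (s : ℝ) < r n
      rw [hrc]
      have : 0 < 1 * ((t : ℝ) - s) / ((n + 1 : ℕ) : ℝ) := by positivity
      exact lt_min hlt (by linarith)
    have hrt : ∀ n, r n ≤ t := by
      intro n
      change (r n : ℝ) ≤ t
      rw [hrc]; exact min_le_left _ _
    have hlim : Tendsto r atTop (𝓝 s) := by
      rw [tendsto_subtype_rng]
      have h1 : Tendsto (fun n : ℕ => (s : ℝ) + 1 * (t - s) / ((n + 1 : ℕ) : ℝ)) atTop
          (𝓝 (s + 0)) := by
        refine Tendsto.const_add _ ?_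
        exact (tendsto_const_div_atTop_nhds_zero_nat (1 * ((t : ℝ) - s))).comp (tendsto_add_atTop_nat 1)
      rw [add_zero] at h1
      refine tendsto_of_tendsto_of_tendsto_of_le_of_le tendsto_const_nhds h1
        (fun n => (hsr n).le) fun n => ?_
      simp only [hrc]
      exact min_le_right _ _
    have hG0 := (filtrationG m T).le s G hG
    have habs : ∀ t x, |G.indicator (Z t) x| ≤ |Z t x| := fun t x => by
      by_cases hx : x ∈ G <;> simp [hx]
    have hconv := tendsto_integral_of_quadraticTail hK (F := fun n => G.indicator (Z (r n)))
      (fun n => (htail₀ (r n)).mono (habs _)) ((htail₀ s).mono (habs _))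
      (fun n => (hZm _ _).indicator hG0) ((hZm _ _).indicator hG0) (fun x => by
        by_cases hx : x ∈ G
        · simp only [Set.indicator_of_mem hx]
          exact ((hZt x).tendsto s).comp hlim
        · simp [hx])
    simp only [integral_indicator hG0] at hconv
    refine tendsto_nhds_unique hconv (tendsto_const_nhds.congr fun n => ?_)
    exact hstep s (r n) t (hsr n) (hrt n) G hG
  -- Adaptedness does not involve the measure, so it is inherited from any one of the approximating
  -- laws.
  refine ⟨hi₀.stronglyAdapted, fun s t hst => ?_⟩
  exact (ae_eq_condExp_of_forall_setIntegral_eq ((filtrationG m T).le s) (hint t)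
    (fun G _ _ => (hint s).integrableOn) (fun G hG _ => hset s t hst G hG)
    (hi₀.stronglyAdapted s).aestronglyMeasurable).symm

end MartingaleLimit

/-! ### The laws in `lawsL` -/

section Laws

variable {m : ℕ} {T : ℝ} {hT : 0 < T} {L : ℝ} {P : ProbabilityMeasure (Enlarged m T)}

theorem ae_mem_enlargedL (hL : 0 ≤ L) (hP : P ∈ lawsL m hT L) :
    ∀ᵐ x ∂(P : Measure (Enlarged m T)), x ∈ enlargedL m hT L :=
  (mem_ae_iff_prob_eq_one (isClosed_enlargedL hT hL).measurableSet).2 hP.1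

theorem continuous_pathM_coord (t : Set.Icc (0 : ℝ) T) (i : Fin m) :
    Continuous fun x : Enlarged m T => pathM x t i :=
  (EuclideanSpace.proj i : Vec m →L[ℝ] ℝ).continuous.comp
    ((continuous_eval_const t).comp continuous_pathM)

theorem continuous_pathM_time (x : Enlarged m T) (i : Fin m) :
    Continuous fun t : Set.Icc (0 : ℝ) T => pathM x t i :=
  (EuclideanSpace.proj i : Vec m →L[ℝ] ℝ).continuous.comp (pathM x).continuous

theorem continuous_symMat_coord (i j : Fin m) : Continuous fun A : SymMat m => A.1 i j :=
  (continuous_apply j).comp ((continuous_apply i).comp continuous_subtype_val)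

theorem continuous_pathQ_coord (t : Set.Icc (0 : ℝ) T) (i j : Fin m) :
    Continuous fun x : Enlarged m T => (pathQ x t).1 i j :=
  (continuous_symMat_coord i j).comp ((continuous_eval_const t).comp continuous_pathQ)

theorem continuous_pathQ_time (x : Enlarged m T) (i j : Fin m) :
    Continuous fun t : Set.Icc (0 : ℝ) T => (pathQ x t).1 i j :=
  (continuous_symMat_coord i j).comp (pathQ x).continuous

theorem pathM_zero (x : Enlarged m T) (t : Set.Icc (0 : ℝ) T) (ht : (t : ℝ) = 0) (i : Fin m) :
    pathM x t i = 0 := by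
  have h : pathM x t = 0 := x.2.2.1.2 t ht
  rw [h]; rfl

theorem pathQ_zero (x : Enlarged m T) (t : Set.Icc (0 : ℝ) T) (ht : (t : ℝ) = 0) :
    pathQ x t = 0 := x.2.2.2.2 t ht

theorem martingale_coord_of_mem (hP : P ∈ lawsL m hT L) (i : Fin m) :
    Martingale (fun t x => pathM x t i) (filtrationG m T) (P : Measure (Enlarged m T)) :=
  martingale_euclidean_iff.1 hP.2.1.1 i

theorem linearIncrementBound_of_mem (hL : 0 ≤ L) (hP : P ∈ lawsL m hT L) (i : Fin m) :
    LinearIncrementBound (P : Measure (Enlarged m T)) (filtrationG m T)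
      (fun t x => pathM x t i) L := by
  refine linearIncrementBound_of_martingale (q := fun t x => (pathQ x t).1 i i)
    (martingale_coord_of_mem hP i) (fun t => (hP.2.1.2 t).eval_piLp i)
    (hP.2.2.martingale i i) ?_
  filter_upwards [ae_mem_enlargedL hL hP] with x hx s t hst
  have h1 := (abs_le.1 (dist_coord_le hx i i t s)).2
  have h2 : (s : ℝ) ≤ t := hst
  rwa [Subtype.dist_eq, Real.dist_eq, abs_of_nonneg (sub_nonneg.2 h2)] at h1

theorem measurable_coord_of_mem (hP : P ∈ lawsL m hT L) (i : Fin m) (t : Set.Icc (0 : ℝ) T) :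
    Measurable[filtrationG m T t] fun x : Enlarged m T => pathM x t i :=
  ((martingale_coord_of_mem hP i).stronglyAdapted t).measurable

theorem quadraticTail_sq_of_mem (hL : 0 ≤ L) (hP : P ∈ lawsL m hT L) (i : Fin m)
    (t : Set.Icc (0 : ℝ) T) :
    QuadraticTail (P : Measure (Enlarged m T)) (fun x => pathM x t i ^ 2)
      (81 * (L * T) ^ 2) :=
  (linearIncrementBound_of_mem hL hP i).quadraticTail_sq hL (measurable_coord_of_mem hP i)
    (fun x => continuous_pathM_time x i) (fun x t ht => pathM_zero x t ht i) t

theorem quadraticTail_of_mem (hL : 0 ≤ L) (hP : P ∈ lawsL m hT L) (i : Fin m)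
    (t : Set.Icc (0 : ℝ) T) :
    QuadraticTail (P : Measure (Enlarged m T)) (fun x => pathM x t i) (9 * (L * T)) :=
  (linearIncrementBound_of_mem hL hP i).quadraticTail hL (measurable_coord_of_mem hP i)
    (fun x => continuous_pathM_time x i) (fun x t ht => pathM_zero x t ht i) t

theorem quadraticTail_mul_sub_of_mem (hL : 0 ≤ L) (hP : P ∈ lawsL m hT L) (i j : Fin m)
    (t : Set.Icc (0 : ℝ) T) :
    QuadraticTail (P : Measure (Enlarged m T))
      (fun x => pathM x t i * pathM x t j - (pathQ x t).1 i j) (652 * (L * T) ^ 2) := by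
  have h1 := (quadraticTail_sq_of_mem hL hP i t).mul_of_sq (quadraticTail_sq_of_mem hL hP j t)
    (by positivity) (by positivity)
  have h2 : QuadraticTail (P : Measure (Enlarged m T)) (fun x => (pathQ x t).1 i j)
      ((L * T) ^ 2) := by
    refine quadraticTail_of_ae_abs_le ?_
    filter_upwards [ae_mem_enlargedL hL hP] with x hx
    let a : Set.Icc (0 : ℝ) T := ⟨0, le_rfl, hT.le⟩
    have h3 := dist_coord_le hx i j t a
    have h4 : (pathQ x a).1 i j = 0 := by rw [pathQ_zero x a rfl]; rfl
    rw [h4, sub_zero] at h3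
    refine h3.trans ?_
    gcongr
    rw [Subtype.dist_eq, Real.dist_eq, sub_zero, abs_of_nonneg t.2.1]
    exact t.2.2
  -- The constant is `652 = 4 * (81 + 81 + 1)`.
  refine (h1.sub h2 (by positivity) (by positivity)).mono_const (le_of_eq ?_)
  ring

/-! ### Tightness -/

theorem vec_dist_le {x y : Vec m} {ε : ℝ} (hε : 0 ≤ ε)
    (h : ∀ i, |x i - y i| ≤ ε / (m + 1)) : dist x y ≤ ε := by
  rw [EuclideanSpace.dist_eq]
  refine Real.sqrt_le_iff.2 ⟨hε, ?_⟩
  calc ∑ i, dist (x i) (y i) ^ 2 ≤ ∑ _i : Fin m, (ε / (m + 1)) ^ 2 := by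
        refine Finset.sum_le_sum fun i _ => ?_
        rw [Real.dist_eq]
        have := h i
        gcongr
    _ = m * (ε / (m + 1)) ^ 2 := by simp
    _ ≤ (m + 1) ^ 2 * (ε / (m + 1)) ^ 2 := by
        gcongr
        nlinarith [Nat.cast_nonneg (α := ℝ) m]
    _ = ε ^ 2 := by field_simp

/-- The compact set is a product of modulus sets. The moduli of `A` and `Q` are deterministic, that
of `M` is chosen so that the exceptional probabilities sum to at most `ε`, and that of `B` follows
from `B = A + M`. -/
theorem isTightMeasureSet_lawsL (hL : 0 < L) :
    IsTightMeasureSet {((P : ProbabilityMeasure (Enlarged m T)) : Measure (Enlarged m T)) |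
      P ∈ lawsL m hT L} := by
  rw [isTightMeasureSet_iff_exists_isCompact_measure_compl_le]
  intro ε hε
  obtain ⟨ε', hε'pos, hε'⟩ := ENNReal.exists_pos_sum_of_countable' hε.ne' ℕ
  -- Chosen so that `6 * lam j` is the coordinatewise oscillation allowed by `vec_dist_le` for `1 /
  -- (j + 1)`.
  let lam : ℕ → ℝ := fun j => 1 / ((j : ℝ) + 1) / (m + 1) / 6
  have hlam : ∀ j, 0 < lam j := fun j => by positivity
  have hN : ∀ j, ∃ N : ℕ, 0 < N ∧
      (m : ENNReal) * ENNReal.ofReal (8 * (L * T) ^ 2 / (lam j ^ 4 * N)) ≤ ε' j := by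
    intro j
    have h1 : Tendsto (fun N : ℕ => 8 * (L * T) ^ 2 / (lam j ^ 4 * N)) atTop (𝓝 0) := by
      simp only [← div_div]
      exact tendsto_const_div_atTop_nhds_zero_nat _
    have h2 := ENNReal.Tendsto.const_mul (a := (m : ENNReal))
      ((ENNReal.continuous_ofReal.tendsto 0).comp h1) (Or.inr (ENNReal.natCast_ne_top m))
    rw [ENNReal.ofReal_zero, mul_zero] at h2
    obtain ⟨N, hN1, hN2⟩ :=
      ((h2.eventually_le_const (hε'pos j)).and (eventually_gt_atTop 0)).exists
    exact ⟨N, hN2, hN1⟩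
  choose N hN0 hN using hN
  let δM : ℕ → ℝ := fun j => T / N j
  let δA : ℕ → ℝ := fun j => 1 / ((j : ℝ) + 1) / L
  -- At index `2 * j + 1` the paths `A` and `M` each oscillate by at most `1 / (2 * j + 2)`, in
  -- total `1 / (j + 1)`.
  let δB : ℕ → ℝ := fun j => min (δA (2 * j + 1)) (δM (2 * j + 1))
  have hδM : ∀ j, 0 < δM j := fun j => div_pos hT (Nat.cast_pos.2 (hN0 j))
  have hδA : ∀ j, 0 < δA j := fun j => by positivity
  have hδB : ∀ j, 0 < δB j := fun j => lt_min (hδA _) (hδM _)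
  let K : Set (Enlarged m T) := (Set.univ ×ˢ modulusSet T (Vec m) δB) ×ˢ
    modulusSet T (Vec m) δA ×ˢ modulusSet T (Vec m) δM ×ˢ modulusSet T (SymMat m) δA
  refine ⟨K, (isCompact_univ.prod (isCompact_modulusSet hδB)).prod
    ((isCompact_modulusSet hδA).prod ((isCompact_modulusSet hδM).prod
      (isCompact_modulusSet hδA))), ?_⟩
  rintro _ ⟨P, hP, rfl⟩
  let bad : ℕ → Fin m → Set (Enlarged m T) := fun j i =>
    {x | ∃ u v, dist u v ≤ T / N j ∧ 6 * lam j < |pathM x u i - pathM x v i|}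
  have hbad : ∀ j i, (P : Measure (Enlarged m T)) (bad j i) ≤
      ENNReal.ofReal (8 * (L * T) ^ 2 / (lam j ^ 4 * N j)) := fun j i =>
    (linearIncrementBound_of_mem hL.le hP i).measure_modulus_gt_le hT hL.le
      (measurable_coord_of_mem hP i) (fun x => continuous_pathM_time x i) (hlam j) (hN0 j)
  have hsub : Kᶜ ⊆ (enlargedL m hT L)ᶜ ∪ ⋃ j, ⋃ i, bad j i := by
    intro x hx
    by_contra hc
    rw [Set.mem_union, not_or, Set.mem_compl_iff, not_not] at hc
    obtain ⟨hxL, hxb⟩ := hc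
    refine hx ?_
    have hM : x.2.2.1 ∈ modulusSet T (Vec m) δM := by
      intro j u v huv
      refine vec_dist_le (by positivity) fun i => ?_
      by_contra hlt
      refine hxb (Set.mem_iUnion.2 ⟨j, Set.mem_iUnion.2 ⟨i, u, v, huv, ?_⟩⟩)
      have e : 6 * lam j = 1 / ((j : ℝ) + 1) / (m + 1) := by
        simp only [lam]; ring
      rw [e]
      exact not_le.1 hlt
    have hrate : ∀ (j : ℕ) (u v : Set.Icc (0 : ℝ) T), dist u v ≤ δA j →
        L * dist u v ≤ 1 / ((j : ℝ) + 1) := by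
      intro j u v huv
      calc L * dist u v ≤ L * (1 / ((j : ℝ) + 1) / L) := by gcongr
        _ = _ := by field_simp
    have hA : x.2.1 ∈ modulusSet T (Vec m) δA := fun j u v huv =>
      (hxL.2.1.dist_le u v).trans (hrate j u v huv)
    have hQ : x.2.2.2 ∈ modulusSet T (SymMat m) δA := fun j u v huv =>
      (hxL.2.2.dist_le u v).trans (hrate j u v huv)
    have hB : x.1.2 ∈ modulusSet T (Vec m) δB := by
      intro j u v huv
      have h1 := hA (2 * j + 1) u v (huv.trans (min_le_left _ _))
      have h2 := hM (2 * j + 1) u v (huv.trans (min_le_right _ _))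
      have e : ∀ u, x.1.2.1 u = x.2.1.1 u + x.2.2.1.1 u := fun u =>
        congrArg (fun f : C(Set.Icc (0 : ℝ) T, Vec m) => f u) hxL.1
      rw [e, e]
      refine (dist_add_add_le _ _ _ _).trans ((add_le_add h1 h2).trans_eq ?_)
      push_cast
      field_simp
      ring
    exact ⟨⟨Set.mem_univ _, hB⟩, hA, hM, hQ⟩
  have h0 : (P : Measure (Enlarged m T)) (enlargedL m hT L)ᶜ = 0 := ae_mem_enlargedL hL.le hP
  calc (P : Measure (Enlarged m T)) Kᶜ
      ≤ (P : Measure (Enlarged m T)) (enlargedL m hT L)ᶜ +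
          (P : Measure (Enlarged m T)) (⋃ j, ⋃ i, bad j i) :=
        (measure_mono hsub).trans (measure_union_le _ _)
    _ ≤ ∑' j, (P : Measure (Enlarged m T)) (⋃ i, bad j i) := by
        rw [h0, zero_add]; exact measure_iUnion_le _
    _ ≤ ∑' j, ε' j := by
        refine ENNReal.tsum_le_tsum fun j => ?_
        calc (P : Measure (Enlarged m T)) (⋃ i, bad j i)
            ≤ ∑ i, (P : Measure (Enlarged m T)) (bad j i) := measure_iUnion_fintype_le _ _
          _ ≤ ∑ _i : Fin m, ENNReal.ofReal (8 * (L * T) ^ 2 / (lam j ^ 4 * N j)) :=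
            Finset.sum_le_sum fun i _ => hbad j i
          _ ≤ ε' j := by simpa using hN j
    _ ≤ ε := hε'.le

/-! ### Closedness -/

theorem isClosed_lawsL (hL : 0 ≤ L) : IsClosed (lawsL m hT L) := by
  refine isClosed_of_closure_subset fun P hP => ?_
  have hne : (𝓝[lawsL m hT L] P).NeBot := mem_closure_iff_nhdsWithin_neBot.1 hP
  have hlim : Tendsto (fun Q : ProbabilityMeasure (Enlarged m T) => Q) (𝓝[lawsL m hT L] P) (𝓝 P) :=
    tendsto_id.mono_left nhdsWithin_le_nhds
  have hmem : ∀ᶠ Q in 𝓝[lawsL m hT L] P, Q ∈ lawsL m hT L := self_mem_nhdsWithin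
  obtain ⟨P₁, hP₁⟩ := hmem.exists
  have hcl := isClosed_enlargedL (m := m) hT hL
  have hT0 := hT.le
  have hnull : (P : Measure (Enlarged m T)) (enlargedL m hT L)ᶜ = 0 := by
    refine le_antisymm (measure_le_of_tendsto_of_isOpen hlim hcl.isOpen_compl ?_) zero_le
    filter_upwards [hmem] with Q hQ
    exact (show (Q : Measure (Enlarged m T)) (enlargedL m hT L)ᶜ = 0 from
      ae_mem_enlargedL hL hQ).le
  have hae : ∀ᵐ x ∂(P : Measure (Enlarged m T)), x ∈ enlargedL m hT L := hnull
  have hcontM := continuous_pathM_coord (m := m) (T := T)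
  have hcontQ := continuous_pathQ_coord (m := m) (T := T)
  refine ⟨(prob_compl_eq_zero_iff hcl.measurableSet).1 hnull, ⟨?_, fun t => ?_⟩, ?_⟩
  · refine martingale_euclidean_iff.2 fun i => martingale_of_tendsto hlim (fun t => hcontM t i)
      (fun x => continuous_pathM_time x i) (K := 9 * (L * T)) (by positivity) ?_ fun t => ?_
    · filter_upwards [hmem] with Q hQ using martingale_coord_of_mem hQ i
    · filter_upwards [hmem] with Q hQ using quadraticTail_of_mem hL hQ i t
  · refine MemLp.of_eval_piLp fun i => ?_
    refine (memLp_two_iff_integrable_sq (hcontM t i).measurable.aestronglyMeasurable).2 ?_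
    refine (quadraticTail_of_tendsto hlim ((hcontM t i).pow 2) (K := 81 * (L * T) ^ 2) ?_).integrable
      (by positivity) ((hcontM t i).pow 2).measurable.aestronglyMeasurable
    filter_upwards [hmem] with Q hQ using quadraticTail_sq_of_mem hL hQ i t
  · refine ⟨hP₁.2.2.adapted, Eventually.of_forall fun x t ht => pathQ_zero x t ht,
      Eventually.of_forall fun x => (pathQ x).continuous, ?_, fun i j => ?_⟩
    · filter_upwards [hae] with x hx
      have hlip : LipschitzWith L.toNNReal (pathQ x) := LipschitzWith.of_dist_le_mul fun u v => by
        rw [Real.coe_toNNReal L hL]; exact hx.2.2.dist_le u v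
      have hmono : BoundedVariationOn (fun t : Set.Icc (0 : ℝ) T => (t : ℝ)) Set.univ :=
        ((Subtype.mono_coe _).monotoneOn _).boundedVariationOn (C := T) fun t _ => by
          rw [abs_of_nonneg t.2.1]; exact t.2.2
      -- Distances in `[0,T]` are those of `ℝ`, so the identity has the variation of the monotone
      -- inclusion; a Lipschitz map preserves its finiteness.
      have hid : BoundedVariationOn (fun t : Set.Icc (0 : ℝ) T => t) Set.univ := hmono
      exact (hlip.lipschitzOnWith (s := Set.univ)).comp_boundedVariationOn
        (Set.mapsTo_univ _ _) hid
    · refine martingale_of_tendsto hlim (fun t => ((hcontM t i).mul (hcontM t j)).sub (hcontQ t i j))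
        (fun x => ((continuous_pathM_time x i).mul (continuous_pathM_time x j)).sub
          (continuous_pathQ_time x i j)) (K := 652 * (L * T) ^ 2) (by positivity) ?_ fun t => ?_
      · filter_upwards [hmem] with Q hQ using hQ.2.2.martingale i j
      · filter_upwards [hmem] with Q hQ using quadraticTail_mul_sub_of_mem hL hQ i j t

end Laws

end PathLaws

end

theorem mainTheorem8 (m : ℕ) (hm : 0 < m) (T : ℝ) (hT : 0 < T) (L : ℝ) (hL : 0 < L) :
    IsCompact (PathLaws.lawsL m hT L) := by
  have h := isCompact_closure_of_isTightMeasureSet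
    (PathLaws.isTightMeasureSet_lawsL (m := m) (hT := hT) hL)
  rwa [(PathLaws.isClosed_lawsL hL.le).closure_eq] at h
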